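/- A (\v{C}ech) closure space $(X,c)$ is a set $X$ with a map $c\colon 2^X\to 2^X$ such that $c(\varnothing)=\varnothing$, $A\subset c(A)$ and $c(A\cup B)=c(A)\cup c(B)$ for all $A,B\subset X$. A map $f\colon(X,c)\to(Y,d)$ is continuous if $f(c(A))\subset d(f(A))$ for all $A\subset X$. A set $V\subset X$ is a neighborhood of $x$ if $x\notin c(X\setminus V)$. A topological space is regarded as a closure space through its topological closure. The product closure $c\times d$ on $X\times Y$ is given by: $(x,y)\in(c\times d)(B)$ if and only if $(V\times W)\cap B\neq\varnothing$ for all neighborhoods $V$ of $x$ and $W$ of $y$. If $q\colon X\to X/{\sim}$ is a quotient map, the quotient closure is $c_q(A)=q(c(q^{-1}(A)))$. Let $I=[0,1]$ with the usual topology $\tau$. The suspension $\Sigma X$ of a closure space $(X,c)$ is the quotient $(X\times I)/{\sim}$ of $(X\times I,c\times\tau)$, with the quotient closure, by the equivalence relation generated by $(x,0)\sim(y,0)$ and $(x,1)\sim(y,1)$ for all $x,y\in X$. For $n\ge 0$ let $H_n(X)$ be the $n$-th integral singular homology group of $(X,c)$: the homology of the chain complex whose $n$-th group is free abelian on the continuous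 maps $\sigma\colon|\Delta^n|\to X$, with $|\Delta^n|$ the standard topological $n$-simplex, and whose boundary is $\partial_n\sigma=\sum_{i=0}^n(-1)^i\,\sigma|_{[e_0,\dots,\hat e_i,\dots,e_n]}$. Proposition. For every closure space $(X,c)$ and every integer $k\ge 1$ there is an isomorphism of groups $H_{k+1}(\Sigma X)\cong H_k(X)$. -/

import Mathlib

universe u v

/-- A (Čech) closure operator on a set `X`; idempotency is not required. -/
@[ext]
structure CechClosure (X : Type u) where
  /-- The closure of a subset. -/
  cl : Set X → Set X
  cl_empty : cl ∅ = ∅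
  subset_cl : ∀ A : Set X, A ⊆ cl A
  cl_union : ∀ A B : Set X, cl (A ∪ B) = cl A ∪ cl B

namespace CechClosure

theorem cl_mono {X : Type u} (c : CechClosure X) {A B : Set X} (h : A ⊆ B) :
    c.cl A ⊆ c.cl B := by
  rw [← Set.union_eq_self_of_subset_left h, c.cl_union]
  exact Set.subset_union_left

/-- The interior operation associated with a closure operator. -/
def interior {X : Type u} (c : CechClosure X) (A : Set X) : Set X := (c.cl Aᶜ)ᶜ

/-- `V` is a neighborhood of the point `x`. -/
def IsNhd {X : Type u} (c : CechClosure X) (V : Set X) (x : X) : Prop := x ∈ c.interior V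

theorem IsNhd.inter {X : Type u} {c : CechClosure X} {V W : Set X} {x : X}
    (hV : c.IsNhd V x) (hW : c.IsNhd W x) : c.IsNhd (V ∩ W) x := by
  unfold IsNhd interior at *
  rw [Set.compl_inter, c.cl_union]
  rintro (h | h)
  · exact hV h
  · exact hW h

theorem IsNhd.mem {X : Type u} {c : CechClosure X} {V : Set X} {x : X}
    (hV : c.IsNhd V x) : x ∈ V := by
  by_contra h
  exact hV (c.subset_cl _ h)

/-- Continuity of a map `f : (X, c) → (Y, d)` of closure spaces. -/
def IsContinuous {X : Type u} {Y : Type v} (c : CechClosure X) (d : CechClosure Y)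
    (f : X → Y) : Prop :=
  ∀ A : Set X, f '' c.cl A ⊆ d.cl (f '' A)

/-- The closure operator of a topological space. -/
def ofTopology (T : Type u) [TopologicalSpace T] : CechClosure T where
  cl := closure
  cl_empty := closure_empty
  subset_cl _ := subset_closure
  cl_union _ _ := closure_union

theorem isContinuous_ofTopology {S : Type u} {T : Type v} [TopologicalSpace S]
    [TopologicalSpace T] {f : S → T} (hf : Continuous f) :
    (ofTopology S).IsContinuous (ofTopology T) f :=
  fun _ => image_closure_subset_closure_image hf

theorem IsContinuous.comp {X Y Z : Type*} {c : CechClosure X} {d : CechClosure Y}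
    {e : CechClosure Z} {g : Y → Z} {f : X → Y} (hg : d.IsContinuous e g)
    (hf : c.IsContinuous d f) : c.IsContinuous e (g ∘ f) := by
  intro A
  rw [Set.image_comp, Set.image_comp]
  exact (Set.image_mono (hf A)).trans (hg _)

/-- The product closure operator `c × d` on `X × Y`. -/
def prod {X : Type u} {Y : Type v} (c : CechClosure X) (d : CechClosure Y) :
    CechClosure (X × Y) where
  cl B := {p | ∀ (V : Set X) (W : Set Y), c.IsNhd V p.1 → d.IsNhd W p.2 →
    ((V ×ˢ W) ∩ B).Nonempty}
  cl_empty := by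
    ext p
    simp only [Set.inter_empty, Set.not_nonempty_empty, Set.mem_ofPred_eq, Set.mem_empty_iff_false,
      iff_false, not_forall]
    exact ⟨Set.univ, Set.univ, by simp [IsNhd, interior, c.cl_empty],
      by simp [IsNhd, interior, d.cl_empty], id⟩
  subset_cl A p hp V W hV hW := ⟨p, ⟨hV.mem, hW.mem⟩, hp⟩
  cl_union A B := by
    ext p
    constructor
    · intro h
      by_contra hn
      simp only [Set.mem_union, Set.mem_ofPred_eq, not_or, not_forall] at hn
      obtain ⟨⟨V, W, hV, hW, h1⟩, V', W', hV', hW', h2⟩ := hn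
      obtain ⟨q, ⟨hq1, hq2⟩, hq⟩ := h _ _ (hV.inter hV') (hW.inter hW')
      rcases hq with hq | hq
      · exact h1 ⟨q, ⟨hq1.1, hq2.1⟩, hq⟩
      · exact h2 ⟨q, ⟨hq1.2, hq2.2⟩, hq⟩
    · rintro (h | h) V W hV hW
      · exact (h V W hV hW).mono (Set.inter_subset_inter_right _ Set.subset_union_left)
      · exact (h V W hV hW).mono (Set.inter_subset_inter_right _ Set.subset_union_right)

/-- The quotient closure operator `A ↦ q (c (q⁻¹ A))` on `X / s`. -/
def quotient {X : Type u} (c : CechClosure X) (s : Setoid X) : CechClosure (Quotient s) where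
  cl A := Quotient.mk s '' c.cl (Quotient.mk s ⁻¹' A)
  cl_empty := by rw [Set.preimage_empty, c.cl_empty, Set.image_empty]
  subset_cl A := by
    intro a ha
    obtain ⟨x, rfl⟩ := Quotient.exists_rep a
    exact ⟨x, c.subset_cl _ ha, rfl⟩
  cl_union A B := by rw [Set.preimage_union, c.cl_union, Set.image_union]

/-- The equivalence relation on `X × [0, 1]` that identifies all the points `(x, 0)` with each
other and all the points `(x, 1)` with each other. -/
def suspensionSetoid (X : Type u) : Setoid (X × unitInterval) where
  r p q := p = q ∨ (p.2 = 0 ∧ q.2 = 0) ∨ (p.2 = 1 ∧ q.2 = 1)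
  iseqv :=
    { refl := fun _ => Or.inl rfl
      symm := by
        rintro p q (h | ⟨h, h'⟩ | ⟨h, h'⟩)
        · exact Or.inl h.symm
        · exact Or.inr (Or.inl ⟨h', h⟩)
        · exact Or.inr (Or.inr ⟨h', h⟩)
      trans := by
        rintro p q r (rfl | ⟨h1, h2⟩ | ⟨h1, h2⟩) (rfl | ⟨h3, h4⟩ | ⟨h3, h4⟩) <;> simp_all }

/-- The underlying set of the suspension of `X`. -/
abbrev Suspension (X : Type u) : Type u := Quotient (suspensionSetoid X)

/-- The closure operator of the suspension of `(X, c)`. -/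
def suspension {X : Type u} (c : CechClosure X) : CechClosure (Suspension X) :=
  (c.prod (ofTopology unitInterval)).quotient (suspensionSetoid X)

open CategoryTheory

/-- The singular `n`-simplices of `(X, c)`: the continuous maps from the standard topological
`n`-simplex to `X`. -/
abbrev SingularSimplex {X : Type u} (c : CechClosure X) (n : ℕ) : Type u :=
  {σ : stdSimplex ℝ (Fin (n + 1)) → X //
    (ofTopology (stdSimplex ℝ (Fin (n + 1)))).IsContinuous c σ}

/-- Precomposition of a singular simplex with the affine map of standard simplices induced by a map
of vertices. -/
noncomputable def SingularSimplex.pullback {X : Type u} {c : CechClosure X} {m n : ℕ}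
    (f : Fin (m + 1) → Fin (n + 1)) (σ : c.SingularSimplex n) : c.SingularSimplex m :=
  ⟨σ.1 ∘ stdSimplex.map f, σ.2.comp (isContinuous_ofTopology (stdSimplex.continuous_map f))⟩

theorem SingularSimplex.pullback_id {X : Type u} {c : CechClosure X} {n : ℕ}
    (σ : c.SingularSimplex n) : σ.pullback id = σ :=
  Subtype.ext (funext fun t => congrArg σ.1 (stdSimplex.map_id_apply t))

theorem SingularSimplex.pullback_comp {X : Type u} {c : CechClosure X} {l m n : ℕ}
    (f : Fin (m + 1) → Fin (n + 1)) (g : Fin (l + 1) → Fin (m + 1)) (σ : c.SingularSimplex n) :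
    (σ.pullback f).pullback g = σ.pullback (f ∘ g) :=
  Subtype.ext (funext fun t => congrArg σ.1 (stdSimplex.map_comp_apply g f t))

/-- The simplicial set of singular simplices of a closure space `(X, c)`. The `i`-th face map is the
restriction to the face opposite to the `i`-th vertex. -/
noncomputable def singularSet {X : Type u} (c : CechClosure X) : SSet.{u} where
  obj n := c.SingularSimplex n.unop.len
  map f := TypeCat.ofHom fun σ => σ.pullback f.unop
  map_id _ := ConcreteCategory.hom_ext _ _ fun σ => SingularSimplex.pullback_id σ
  map_comp f g := ConcreteCategory.hom_ext _ _ fun σ =>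
    (SingularSimplex.pullback_comp f.unop g.unop σ).symm

/-- The free abelian group functor: a set `S` is sent to the group of finitely supported functions
`S →₀ ℤ`. -/
noncomputable def freeAbelian : Type u ⥤ ModuleCat.{u} ℤ where
  obj S := ModuleCat.of ℤ (S →₀ ℤ)
  map f := ModuleCat.ofHom (Finsupp.lmapDomain ℤ ℤ f)
  map_id S := by
    ext; simp
  map_comp f g := by
    ext; simp

/-- The singular chain complex of `(X, c)`: in degree `n` it is the free abelian group on the
singular `n`-simplices, and the boundary map is the alternating sum of the face maps. -/
noncomputable def singularChainComplex {X : Type u} (c : CechClosure X) :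
    ChainComplex (ModuleCat.{u} ℤ) ℕ :=
  (AlgebraicTopology.alternatingFaceMapComplex (ModuleCat.{u} ℤ)).obj
    (((SimplicialObject.whiskering (Type u) (ModuleCat.{u} ℤ)).obj freeAbelian.{u}).obj c.singularSet)

/-- The `n`-th singular homology group `H_n(X, c)`. -/
noncomputable def singularHomology {X : Type u} (c : CechClosure X) (n : ℕ) : ModuleCat.{u} ℤ :=
  c.singularChainComplex.homology n

end CechClosure

/-!
# The suspension isomorphism for singular homology of closure spaces

The suspension `ΣX` is covered by two cones, the complements of its two poles, whose intersection
is `X × (0, 1)`. The cones are contractible and the intersection is homotopy equivalent to `X`, so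
the connecting homomorphism of the Mayer–Vietoris sequence of this cover is the required
isomorphism. For closure spaces each ingredient has to be checked for continuity with respect to
the product and quotient closures.

* Continuity is expressed by neighbourhood filters (`CechClosure.isContinuous_iff_tendsto`). The
  neighbourhoods of a point of `ΣX` are described by `CechClosure.mem_nhd_suspension`; those of a
  pole are the sets whose preimage in `X × [0, 1]` is a neighbourhood of every point of the collapsed end.
  The homotopies used here only move the height coordinate, and `CechClosure.tendsto_slide` shows
  that they are continuous, also at a pole, where compactness of the parameter interval is used.

* The height `ΣX → [0, 1]` is continuous, so every singular simplex of `ΣX` pulls the two cones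
  back to an open cover of a standard simplex in the ordinary topological sense. Hence
  barycentric subdivision works as for topological spaces: it is constructed on affine chains
  (`TupleChain.sd`), shown to be chain homotopic to the identity (`TupleChain.bd_sdHomotopy`) and to
  become arbitrarily fine (`TupleChain.eventually_sd_pow_mem`), and carried over to singular chains
  by naturality. By `CechClosure.isIso_homologyMap_subcomplex` the simplices lying in one of the
  two cones compute the homology of `ΣX` (`CechClosure.isIso_homologyMap_cones`).

* For two subcomplexes `A`, `B` of a simplicial set the chains of `A ⊓ B`, `A`, `B` and `A ⊔ B`
  form the Mayer–Vietoris short exact sequence, see `SSet.nonempty_mayerVietorisIso`.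

* Homotopies of maps of closure spaces give simplicial homotopies on singular simplices
  (`CechClosure.homotopyOn`), hence the cones are acyclic in positive degrees and the intersection
  has the homology of `X` (`CechClosure.homologyEquatorIso`).
-/

section

open Filter Topology

namespace CechClosure

/-! ### Neighbourhood filters -/

/-- The filter of neighbourhoods of a point of a closure space. -/
def nhd {X : Type u} (c : CechClosure X) (x : X) : Filter X where
  sets := {V | c.IsNhd V x}
  univ_sets := by simp [IsNhd, interior, c.cl_empty]
  sets_of_superset {V W} hV hVW := fun h => hV (c.cl_mono (Set.compl_subset_compl.2 hVW) h)
  inter_sets hV hW := hV.inter hW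

theorem mem_nhd {X : Type u} {c : CechClosure X} {x : X} {V : Set X} :
    V ∈ c.nhd x ↔ x ∉ c.cl Vᶜ := Iff.rfl

theorem mem_cl_iff_frequently {X : Type u} {c : CechClosure X} {x : X} {A : Set X} :
    x ∈ c.cl A ↔ ∃ᶠ y in c.nhd x, y ∈ A := by
  rw [Filter.Frequently, Filter.Eventually, mem_nhd, not_not]
  simp only [Set.compl_ofPred, not_not, Set.ofPred_mem_eq]

theorem nhd_ofTopology {T : Type u} [TopologicalSpace T] (t : T) :
    (ofTopology T).nhd t = 𝓝 t := by
  ext V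
  rw [mem_nhd, ← mem_interior_iff_mem_nhds]
  simp [ofTopology, closure_compl]

theorem isContinuous_iff_tendsto {X : Type u} {Y : Type v} {c : CechClosure X}
    {d : CechClosure Y} {f : X → Y} :
    c.IsContinuous d f ↔ ∀ x, Tendsto f (c.nhd x) (d.nhd (f x)) := by
  constructor
  · intro h x V hV
    rw [mem_map, mem_nhd]
    refine fun hx => hV (d.cl_mono ?_ (h _ ⟨x, hx, rfl⟩))
    rintro _ ⟨y, hy, rfl⟩
    exact hy
  · rintro h A _ ⟨x, hx, rfl⟩
    rw [mem_cl_iff_frequently] at hx ⊢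
    exact (h x).frequently (hx.mono fun y hy => ⟨y, hy, rfl⟩)

theorem nhd_prod {X : Type u} {Y : Type v} (c : CechClosure X) (d : CechClosure Y) (p : X × Y) :
    (c.prod d).nhd p = c.nhd p.1 ×ˢ d.nhd p.2 := by
  ext B
  rw [mem_nhd, mem_prod_iff]
  simp only [CechClosure.prod, Set.mem_ofPred_eq, not_forall]
  constructor
  · rintro ⟨V, W, hV, hW, h⟩
    refine ⟨V, hV, W, hW, fun q hq => ?_⟩
    by_contra hB
    exact h ⟨q, hq, hB⟩
  · rintro ⟨V, hV, W, hW, h⟩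
    exact ⟨V, W, hV, hW, fun ⟨q, hq, hB⟩ => hB (h hq)⟩

theorem mem_nhd_quotient {X : Type u} {c : CechClosure X} {s : Setoid X} {a : Quotient s}
    {V : Set (Quotient s)} :
    V ∈ (c.quotient s).nhd a ↔ ∀ x, Quotient.mk s x = a → Quotient.mk s ⁻¹' V ∈ c.nhd x := by
  rw [mem_nhd]
  simp only [quotient, Set.mem_image, not_exists, not_and, mem_nhd, Set.preimage_compl]
  exact forall_congr' fun x => not_imp_not.symm.trans (by simp)

/-! ### The suspension -/

namespace Suspension

variable {X : Type u}

/-- The class of `(x, t)` in the suspension. -/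
def point (x : X) (t : unitInterval) : Suspension X := Quotient.mk _ (x, t)

theorem point_eq_point {x y : X} {s t : unitInterval} :
    point x s = point y t ↔ (x = y ∧ s = t) ∨ (s = 0 ∧ t = 0) ∨ (s = 1 ∧ t = 1) := by
  rw [point, point, Quotient.eq]
  change ((x, s) = (y, t) ∨ _) ↔ _
  rw [Prod.mk.injEq]

/-- The second coordinate, as a function on the suspension. -/
def height (y : Suspension X) : unitInterval :=
  Quotient.lift (fun p : X × unitInterval => p.2) (by
    rintro p q (h | ⟨h, h'⟩ | ⟨h, h'⟩)
    · exact congrArg _ h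
    · exact h.trans h'.symm
    · exact h.trans h'.symm) y

@[simp]
theorem height_point (x : X) (t : unitInterval) : height (point x t) = t := rfl

/-- The first coordinate of a representative. It is determined by the point except at the two
poles, where the choice is arbitrary. -/
noncomputable def base (y : Suspension X) : X := (Quotient.out y).1

@[simp]
theorem point_base_height (y : Suspension X) : point y.base y.height = y := by
  have h : point y.base (Quotient.out y).2 = y := Quotient.out_eq y
  conv_rhs => rw [← h]
  rw [← h, height_point, h]

theorem base_point {x : X} {t : unitInterval} (h0 : t ≠ 0) (h1 : t ≠ 1) : base (point x t) = x := by
  have h := point_base_height (point x t)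
  rw [point_eq_point, height_point] at h
  tauto

theorem eq_of_height_eq {y z : Suspension X} (h : y.height = z.height)
    (hy : y.height = 0 ∨ y.height = 1) : y = z := by
  rw [← point_base_height y, ← point_base_height z, point_eq_point]
  rw [← h]
  tauto

end Suspension

open Suspension

variable {X : Type u} (c : CechClosure X)

theorem mem_nhd_suspension {y : Suspension X} {V : Set (Suspension X)} :
    V ∈ c.suspension.nhd y ↔
      ∀ x t, point x t = y → ∀ᶠ p in c.nhd x ×ˢ 𝓝 t, point p.1 p.2 ∈ V := by
  simp only [suspension, mem_nhd_quotient, nhd_prod, nhd_ofTopology, Prod.forall]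
  rfl

theorem tendsto_point (x : X) (t : unitInterval) :
    Tendsto (fun p : X × unitInterval => point p.1 p.2) (c.nhd x ×ˢ 𝓝 t)
      (c.suspension.nhd (point x t)) :=
  fun _ hV => (c.mem_nhd_suspension.1 hV) x t rfl

theorem tendsto_height (y : Suspension X) :
    Tendsto (height (X := X)) (c.suspension.nhd y) (𝓝 y.height) := by
  intro V hV
  rw [mem_map, mem_nhd_suspension]
  rintro x t rfl
  exact tendsto_snd.eventually hV

/-- Away from the poles, the base coordinate is continuous. -/
theorem tendsto_base {y : Suspension X} (h0 : y.height ≠ 0) (h1 : y.height ≠ 1) :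
    Tendsto (base (X := X)) (c.suspension.nhd y) (c.nhd y.base) := by
  intro V hV
  rw [mem_map, mem_nhd_suspension]
  rintro x t rfl
  rw [height_point] at h0 h1
  rw [base_point h0 h1] at hV
  filter_upwards [tendsto_fst.eventually hV, tendsto_snd.eventually (isOpen_ne.mem_nhds h0),
    tendsto_snd.eventually (isOpen_ne.mem_nhds h1)] with p hp hp0 hp1
  rw [Set.mem_preimage, base_point hp0 hp1]
  exact hp

/-- Apply a self-map of the interval, depending on a parameter `s`, to the height. -/
noncomputable def slide (m : unitInterval → unitInterval → unitInterval) (y : Suspension X)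
    (s : unitInterval) : Suspension X := point y.base (m y.height s)

@[simp]
theorem height_slide (m : unitInterval → unitInterval → unitInterval) (y : Suspension X)
    (s : unitInterval) : (slide m y s).height = m y.height s := rfl

theorem slide_point {m : unitInterval → unitInterval → unitInterval} {x : X} {t s : unitInterval}
    (h0 : t = 0 → m 0 s = 0) (h1 : t = 1 → m 1 s = 1) : slide m (point x t) s = point x (m t s) := by
  rw [slide, point_eq_point, height_point]
  by_cases h0' : t = 0
  · subst h0'; simp [h0 rfl]
  by_cases h1' : t = 1
  · subst h1'; simp [h1 rfl]
  rw [base_point h0' h1']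
  simp

theorem tendsto_slide {m : unitInterval → unitInterval → unitInterval}
    (hm : Continuous fun p : unitInterval × unitInterval => m p.1 p.2)
    {y : Suspension X} (h0 : y.height = 0 → ∀ s, m 0 s = 0) (h1 : y.height = 1 → ∀ s, m 1 s = 1)
    (s : unitInterval) :
    Tendsto (fun p : Suspension X × unitInterval => slide m p.1 p.2)
      (c.suspension.nhd y ×ˢ 𝓝 s) (c.suspension.nhd (slide m y s)) := by
  by_cases hy : y.height = 0 ∨ y.height = 1
  · -- At a pole fixed by `m`, compactness of the parameter interval gives a neighbourhood that
    -- works for all parameters at once.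
    have hfix : ∀ s, m y.height s = y.height := by
      rcases hy with h | h
      · simpa [h] using h0 h
      · simpa [h] using h1 h
    have hs : slide m y s = y := (eq_of_height_eq ((height_slide m y s).trans (hfix s)).symm hy).symm
    rw [hs]
    intro V hV
    have hu : ∀ᶠ z in c.suspension.nhd y, ∀ s, slide m z s ∈ V := by
      change {z | ∀ s, slide m z s ∈ V} ∈ _
      rw [mem_nhd_suspension] at hV ⊢
      intro x t hxt
      have ht : y.height = t := by rw [← hxt, height_point]
      obtain ⟨A, hA, B, hB, hAB⟩ := mem_prod_iff.1 (hV x t hxt)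
      have hB' : ∀ᶠ t' in 𝓝 t, ∀ s, m t' s ∈ B := by
        have h := isCompact_univ.eventually_forall_of_forall_eventually
          (x₀ := t) (P := fun t' s => m t' s ∈ B) (fun s _ => by
            refine hm.continuousAt.eventually (?_ : B ∈ _)
            change B ∈ 𝓝 (m t s)
            rw [← ht, hfix, ht]; exact hB)
        simpa using h
      have hne : ∀ᶠ t' in 𝓝 t, (t' = 0 → t = 0) ∧ (t' = 1 → t = 1) := by
        refine Eventually.and ?_ ?_
        · by_cases h : t = 0
          · simp [h]
          · exact Eventually.mono (isOpen_ne.mem_nhds h) fun t' ht' h' => (ht' h').elim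
        · by_cases h : t = 1
          · simp [h]
          · exact Eventually.mono (isOpen_ne.mem_nhds h) fun t' ht' h' => (ht' h').elim
      filter_upwards [tendsto_fst.eventually hA, tendsto_snd.eventually hB',
        tendsto_snd.eventually hne] with p hpA hpB hpne s
      rw [slide_point (fun h => h0 (ht.trans (hpne.1 h)) s) (fun h => h1 (ht.trans (hpne.2 h)) s)]
      exact @hAB (p.1, m p.2 s) ⟨hpA, hpB s⟩
    exact (tendsto_fst.eventually hu).mono fun p hp => hp p.2
  · rw [not_or] at hy
    have h : Tendsto (fun p : Suspension X × unitInterval => (p.1.base, m p.1.height p.2))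
        (c.suspension.nhd y ×ˢ 𝓝 s) (c.nhd y.base ×ˢ 𝓝 (m y.height s)) := by
      have h' : Tendsto (fun p : Suspension X × unitInterval => (p.1.height, p.2))
          (c.suspension.nhd y ×ˢ 𝓝 s) (𝓝 (y.height, s)) := by
        rw [nhds_prod_eq]
        exact ((c.tendsto_height y).comp tendsto_fst).prodMk tendsto_snd
      exact ((c.tendsto_base hy.1 hy.2).comp tendsto_fst).prodMk
        ((hm.tendsto (y.height, s)).comp h')
    exact (c.tendsto_point y.base (m y.height s)).comp h

end CechClosure

end

section

/-! ### Affine maps out of a simplex -/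

namespace stdSimplex

variable {ι κ μ : Type*} [Fintype ι] [Fintype κ] [Fintype μ]

/-- The affine map out of the standard simplex with prescribed images of the vertices. -/
noncomputable def affine (v : ι → stdSimplex ℝ κ) (t : stdSimplex ℝ ι) : stdSimplex ℝ κ :=
  ⟨∑ i, t.1 i • (v i).1,
    (convex_stdSimplex ℝ κ).sum_mem (fun i _ => t.2.1 i) t.2.2 fun i _ => (v i).2⟩

theorem affine_val (v : ι → stdSimplex ℝ κ) (t : stdSimplex ℝ ι) (k : κ) :
    (affine v t).1 k = ∑ i, t.1 i * (v i).1 k := by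
  simp [affine]

theorem affine_affine (w : κ → stdSimplex ℝ μ) (v : ι → stdSimplex ℝ κ) (t : stdSimplex ℝ ι) :
    affine w (affine v t) = affine (affine w ∘ v) t := by
  refine Subtype.ext (funext fun k => ?_)
  simp only [affine_val, Function.comp_apply, Finset.sum_mul, Finset.mul_sum, mul_assoc]
  exact Finset.sum_comm

theorem affine_vertex [DecidableEq ι] (v : ι → stdSimplex ℝ κ) (i : ι) :
    affine v (vertex i) = v i := by
  refine Subtype.ext (funext fun k => ?_)
  simp [affine_val, Pi.single_apply]

theorem map_eq_affine [DecidableEq κ] (f : ι → κ) (t : stdSimplex ℝ ι) :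
    map f t = affine (fun i => vertex (f i)) t := by
  refine Subtype.ext (funext fun k => ?_)
  rw [affine_val]
  change FunOnFinite.linearMap ℝ ℝ f t k = _
  rw [FunOnFinite.linearMap_apply_apply]
  simp only [Pi.single_apply, mul_ite, mul_one, mul_zero, Finset.sum_ite, Finset.sum_const_zero,
    add_zero]
  refine Finset.sum_congr ?_ fun _ _ => rfl
  ext i
  simp [eq_comm]

theorem affine_map (v : κ → stdSimplex ℝ μ) (f : ι → κ) (t : stdSimplex ℝ ι) :
    affine v (map f t) = affine (v ∘ f) t := by
  classical
  rw [map_eq_affine, affine_affine]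
  congr 1
  funext i
  exact affine_vertex v (f i)

theorem affine_vertices [DecidableEq ι] (t : stdSimplex ℝ ι) : affine vertex t = t := by
  rw [← map_id_apply t, affine_map, map_eq_affine]
  rfl

theorem continuous_affine (v : ι → stdSimplex ℝ κ) : Continuous (affine v) := by
  refine Continuous.subtype_mk ?_ _
  exact continuous_finsetSum _ fun i _ =>
    ((continuous_apply i).comp continuous_subtype_val).smul continuous_const

theorem range_affine_comp_subset (v : κ → stdSimplex ℝ μ) (f : ι → κ) :
    Set.range (affine (v ∘ f)) ⊆ Set.range (affine v) := by
  rintro _ ⟨t, rfl⟩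
  exact ⟨map f t, affine_map v f t⟩

/-- The barycenter of the affine simplex with the given vertices. -/
noncomputable def center [Nonempty ι] (v : ι → stdSimplex ℝ κ) : stdSimplex ℝ κ :=
  affine v barycenter

theorem affine_center [Nonempty ι] (w : κ → stdSimplex ℝ μ) (v : ι → stdSimplex ℝ κ) :
    affine w (center v) = center (affine w ∘ v) :=
  affine_affine w v _

end stdSimplex

/-! ### Chains of ordered tuples -/

/-- Integral chains on `n`-tuples of elements of `E`: the augmented chain complex of the full
simplex with vertex set `E`, with the degree shifted by one so that `n = 0` is the augmentation. -/
abbrev TupleChain (E : Type*) (n : ℕ) : Type _ := (Fin n → E) →₀ ℤ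

namespace TupleChain

open Finsupp

variable {E F : Type*} {n : ℕ}

/-- The boundary: the alternating sum of the tuples with one entry omitted. -/
noncomputable def bd : TupleChain E (n + 1) →ₗ[ℤ] TupleChain E n :=
  ∑ i : Fin (n + 1), (-1 : ℤ) ^ (i : ℕ) • lmapDomain ℤ ℤ fun v => v ∘ i.succAbove

/-- The cone with apex `b`: insert `b` in front. -/
noncomputable def cone (b : E) : TupleChain E n →ₗ[ℤ] TupleChain E (n + 1) :=
  lmapDomain ℤ ℤ (Fin.cons (α := fun _ => E) b)

/-- The map induced by a map of vertices. -/
noncomputable def map (f : E → F) : TupleChain E n →ₗ[ℤ] TupleChain F n :=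
  lmapDomain ℤ ℤ fun v => f ∘ v

theorem bd_single (v : Fin (n + 1) → E) (a : ℤ) :
    bd (single v a) = ∑ i : Fin (n + 1), (-1 : ℤ) ^ (i : ℕ) • single (v ∘ i.succAbove) a := by
  simp only [bd, LinearMap.sum_apply, LinearMap.smul_apply, lmapDomain_apply, mapDomain_single]

theorem cone_single (b : E) (v : Fin n → E) (a : ℤ) :
    cone b (single v a) = single (Fin.cons (α := fun _ => E) b v) a := by
  simp only [cone, lmapDomain_apply, mapDomain_single]

theorem map_single (f : E → F) (v : Fin n → E) (a : ℤ) :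
    map f (single v a) = single (f ∘ v) a := by
  simp only [map, lmapDomain_apply, mapDomain_single]

theorem cons_comp_succAbove_succ (b : E) (v : Fin (n + 1) → E) (i : Fin (n + 1)) :
    Fin.cons (α := fun _ => E) b v ∘ i.succ.succAbove =
      Fin.cons (α := fun _ => E) b (v ∘ i.succAbove) := by
  funext j
  refine Fin.cases ?_ (fun j => ?_) j <;> simp

theorem bd_cone_zero (b : E) (x : TupleChain E 0) : bd (cone b x) = x := by
  induction x using Finsupp.induction_linear with
  | zero => simp
  | add x y hx hy => rw [map_add, map_add, hx, hy]
  | single v a =>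
    rw [cone_single, bd_single, Fin.sum_univ_one]
    simp

theorem bd_cone (b : E) (x : TupleChain E (n + 1)) : bd (cone b x) = x - cone b (bd x) := by
  induction x using Finsupp.induction_linear with
  | zero => simp
  | add x y hx hy => simp only [map_add, hx, hy]; abel
  | single v a =>
    rw [cone_single, bd_single, bd_single, Fin.sum_univ_succ, map_sum, sub_eq_add_neg,
      ← Finset.sum_neg_distrib]
    congr 1
    · simp
    · refine Finset.sum_congr rfl fun i _ => ?_
      rw [map_zsmul, cone_single, cons_comp_succAbove_succ, Fin.val_succ, pow_succ]
      simp

theorem bd_bd (x : TupleChain E (n + 2)) : bd (bd x) = 0 := by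
  induction n with
  | zero =>
    induction x using Finsupp.induction_linear with
    | zero => simp
    | add x y hx hy => simp only [map_add, hx, hy, add_zero]
    | single v a =>
      rw [← Fin.cons_self_tail v, ← cone_single, bd_cone, map_sub, bd_cone_zero, sub_self]
  | succ n ih =>
    induction x using Finsupp.induction_linear with
    | zero => simp
    | add x y hx hy => simp only [map_add, hx, hy, add_zero]
    | single v a =>
      rw [← Fin.cons_self_tail v, ← cone_single, bd_cone, map_sub, bd_cone, ih, map_zero,
        sub_zero, sub_self]

theorem map_bd (f : E → F) (x : TupleChain E (n + 1)) : map f (bd x) = bd (map f x) := by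
  induction x using Finsupp.induction_linear with
  | zero => simp
  | add x y hx hy => simp only [map_add, hx, hy]
  | single v a =>
    simp only [bd_single, map_single, map_sum, map_zsmul]
    rfl

theorem map_cone (f : E → F) (b : E) (x : TupleChain E n) :
    map f (cone b x) = cone (f b) (map f x) := by
  induction x using Finsupp.induction_linear with
  | zero => simp
  | add x y hx hy => simp only [map_add, hx, hy]
  | single v a =>
    rw [cone_single, map_single, map_single, cone_single]
    congr 1
    funext j
    refine Fin.cases ?_ (fun j => ?_) j <;> simp

/-! ### Barycentric subdivision of affine chains -/

section Subdivision

open stdSimplex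

variable {κ μ : Type*} [Fintype κ] [Fintype μ]

/-- Barycentric subdivision: cone off the subdivided boundary from the barycenter. -/
noncomputable def sd : ∀ n, TupleChain (stdSimplex ℝ κ) n →ₗ[ℤ] TupleChain (stdSimplex ℝ κ) n
  | 0 => LinearMap.id
  | n + 1 => linearCombination ℤ fun v => cone (center v) (sd n (bd (single v 1)))

/-- The chain homotopy between the identity and barycentric subdivision. -/
noncomputable def sdHomotopy :
    ∀ n, TupleChain (stdSimplex ℝ κ) n →ₗ[ℤ] TupleChain (stdSimplex ℝ κ) (n + 1)
  | 0 => 0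
  | n + 1 => linearCombination ℤ fun v =>
      cone (center v) (single v 1 - sdHomotopy n (bd (single v 1)))

theorem sd_succ_single (v : Fin (n + 1) → stdSimplex ℝ κ) :
    sd (n + 1) (single v 1) = cone (center v) (sd n (bd (single v 1))) := by
  simp [sd]

theorem sdHomotopy_succ_single (v : Fin (n + 1) → stdSimplex ℝ κ) :
    sdHomotopy (n + 1) (single v 1) =
      cone (center v) (single v 1 - sdHomotopy n (bd (single v 1))) := by
  simp [sdHomotopy]

/-- To prove an identity of additive maps on chains, it suffices to check it on tuples. -/
theorem hom_ext {M : Type*} [AddCommGroup M] {f g : TupleChain E n →ₗ[ℤ] M}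
    (h : ∀ v, f (single v 1) = g (single v 1)) : f = g :=
  Finsupp.lhom_ext' fun v => LinearMap.ext_ring (h v)

theorem bd_sd (x : TupleChain (stdSimplex ℝ κ) (n + 1)) : bd (sd (n + 1) x) = sd n (bd x) := by
  induction n with
  | zero =>
    refine LinearMap.congr_fun (f := bd ∘ₗ sd 1) (g := sd 0 ∘ₗ bd) (hom_ext fun v => ?_) x
    rw [LinearMap.comp_apply, LinearMap.comp_apply, sd_succ_single, bd_cone_zero]
  | succ n ih =>
    refine LinearMap.congr_fun (f := bd ∘ₗ sd (n + 2)) (g := sd (n + 1) ∘ₗ bd)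
      (hom_ext fun v => ?_) x
    rw [LinearMap.comp_apply, LinearMap.comp_apply, sd_succ_single, bd_cone, ih, bd_bd, map_zero,
      map_zero, sub_zero]

theorem bd_sdHomotopy (x : TupleChain (stdSimplex ℝ κ) (n + 1)) :
    bd (sdHomotopy (n + 1) x) + sdHomotopy n (bd x) = x - sd (n + 1) x := by
  induction n with
  | zero =>
    refine LinearMap.congr_fun (f := bd ∘ₗ sdHomotopy 1 + sdHomotopy 0 ∘ₗ bd)
      (g := LinearMap.id - sd 1) (hom_ext fun v => ?_) x
    simp only [LinearMap.add_apply, LinearMap.comp_apply, LinearMap.sub_apply, LinearMap.id_apply,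
      sdHomotopy_succ_single, sd_succ_single, bd_cone]
    simp [sdHomotopy, sd]
  | succ n ih =>
    refine LinearMap.congr_fun (f := bd ∘ₗ sdHomotopy (n + 2) + sdHomotopy (n + 1) ∘ₗ bd)
      (g := LinearMap.id - sd (n + 2)) (hom_ext fun v => ?_) x
    simp only [LinearMap.add_apply, LinearMap.comp_apply, LinearMap.sub_apply, LinearMap.id_apply,
      sdHomotopy_succ_single, sd_succ_single, bd_cone]
    have h : bd (sdHomotopy (n + 1) (bd (single v 1))) =
        bd (single v 1) - sd (n + 1) (bd (single v 1)) := by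
      simpa [bd_bd] using ih (bd (single v 1))
    rw [map_sub bd, h]
    simp only [map_sub]
    abel

theorem map_sd (w : κ → stdSimplex ℝ μ) (x : TupleChain (stdSimplex ℝ κ) n) :
    map (affine w) (sd n x) = sd n (map (affine w) x) := by
  induction n with
  | zero => rfl
  | succ n ih =>
    refine LinearMap.congr_fun (f := map (affine w) ∘ₗ sd (n + 1)) (g := sd (n + 1) ∘ₗ map _)
      (hom_ext fun v => ?_) x
    rw [LinearMap.comp_apply, LinearMap.comp_apply, sd_succ_single, map_cone, ih, map_bd,
      map_single, sd_succ_single, affine_center]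

theorem map_sdHomotopy (w : κ → stdSimplex ℝ μ) (x : TupleChain (stdSimplex ℝ κ) n) :
    map (affine w) (sdHomotopy n x) = sdHomotopy n (map (affine w) x) := by
  induction n with
  | zero => simp [sdHomotopy]
  | succ n ih =>
    refine LinearMap.congr_fun (f := map (affine w) ∘ₗ sdHomotopy (n + 1))
      (g := sdHomotopy (n + 1) ∘ₗ map _) (hom_ext fun v => ?_) x
    rw [LinearMap.comp_apply, LinearMap.comp_apply, sdHomotopy_succ_single, map_cone, map_sub,
      ih, map_bd, map_single, sdHomotopy_succ_single, affine_center]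

/-! ### Iterated subdivision -/

theorem bd_sd_pow (m : ℕ) (x : TupleChain (stdSimplex ℝ κ) (n + 1)) :
    bd ((sd (n + 1) ^ m) x) = (sd n ^ m) (bd x) := by
  induction m with
  | zero => rfl
  | succ m ih => rw [pow_succ', pow_succ', Module.End.mul_apply, Module.End.mul_apply, bd_sd, ih]

theorem map_sd_pow (m : ℕ) (w : κ → stdSimplex ℝ μ) (x : TupleChain (stdSimplex ℝ κ) n) :
    map (affine w) ((sd n ^ m) x) = (sd n ^ m) (map (affine w) x) := by
  induction m with
  | zero => rfl
  | succ m ih => rw [pow_succ', pow_succ', Module.End.mul_apply, Module.End.mul_apply, map_sd, ih]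

/-- The chain homotopy between the identity and the `m`-fold barycentric subdivision. -/
noncomputable def sdPowHomotopy (m n : ℕ) :
    TupleChain (stdSimplex ℝ κ) n →ₗ[ℤ] TupleChain (stdSimplex ℝ κ) (n + 1) :=
  ∑ i ∈ Finset.range m, sdHomotopy n ∘ₗ (sd n ^ i)

theorem sdPowHomotopy_succ (m : ℕ) (x : TupleChain (stdSimplex ℝ κ) n) :
    sdPowHomotopy (m + 1) n x = sdPowHomotopy m n x + sdHomotopy n ((sd n ^ m) x) := by
  simp [sdPowHomotopy, Finset.sum_range_succ]

theorem bd_sdPowHomotopy (m : ℕ) (x : TupleChain (stdSimplex ℝ κ) (n + 1)) :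
    bd (sdPowHomotopy m (n + 1) x) + sdPowHomotopy m n (bd x) = x - (sd (n + 1) ^ m) x := by
  induction m with
  | zero => simp [sdPowHomotopy]
  | succ m ih =>
    have h := bd_sdHomotopy ((sd (n + 1) ^ m) x)
    rw [bd_sd_pow] at h
    rw [sdPowHomotopy_succ, sdPowHomotopy_succ, map_add, add_add_add_comm, ih, h, pow_succ',
      Module.End.mul_apply]
    abel

theorem map_sdPowHomotopy (m : ℕ) (w : κ → stdSimplex ℝ μ)
    (x : TupleChain (stdSimplex ℝ κ) n) :
    map (affine w) (sdPowHomotopy m n x) = sdPowHomotopy m n (map (affine w) x) := by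
  simp [sdPowHomotopy, map_sdHomotopy, map_sd_pow]

/-! ### The mesh of the iterated subdivision -/

theorem _root_.Finsupp.map_mem_of_mem_supported {α N : Type*} [AddCommGroup N]
    (f : (α →₀ ℤ) →ₗ[ℤ] N) (p : Submodule ℤ N) {S : Set α}
    (h : ∀ a ∈ S, f (single a 1) ∈ p) {x : α →₀ ℤ} (hx : x ∈ supported ℤ ℤ S) : f x ∈ p := by
  rw [supported_eq_span_single] at hx
  have hle : Submodule.span ℤ ((fun a => single a (1 : ℤ)) '' S) ≤ p.comap f := by
    rw [Submodule.span_le]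
    rintro _ ⟨a, ha, rfl⟩
    exact h a ha
  exact hle hx

theorem _root_.stdSimplex.dist_le_iff {x y : stdSimplex ℝ κ} {r : ℝ} (hr : 0 ≤ r) :
    dist x y ≤ r ↔ ∀ k, |x.1 k - y.1 k| ≤ r := by
  rw [Subtype.dist_eq, dist_pi_le_iff hr]
  rfl

theorem _root_.stdSimplex.dist_affine_le {ι : Type*} [Fintype ι] {v : ι → stdSimplex ℝ κ}
    {x : stdSimplex ℝ κ} {r : ℝ} (hr : 0 ≤ r) (h : ∀ i, dist x (v i) ≤ r) (t : stdSimplex ℝ ι) :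
    dist x (affine v t) ≤ r := by
  rw [dist_le_iff hr]
  intro k
  have h1 : x.1 k - (affine v t).1 k = ∑ i, t.1 i * (x.1 k - (v i).1 k) := by
    rw [affine_val]
    simp only [mul_sub, Finset.sum_sub_distrib, ← Finset.sum_mul, t.2.2, one_mul]
  rw [h1]
  calc |∑ i, t.1 i * (x.1 k - (v i).1 k)| ≤ ∑ i, |t.1 i * (x.1 k - (v i).1 k)| :=
        Finset.abs_sum_le_sum_abs _ _
    _ ≤ ∑ i, t.1 i * r := by
        refine Finset.sum_le_sum fun i _ => ?_
        rw [abs_mul, abs_of_nonneg (t.2.1 i)]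
        exact mul_le_mul_of_nonneg_left ((dist_le_iff hr).1 (h i) k) (t.2.1 i)
    _ = r := by rw [← Finset.sum_mul, t.2.2, one_mul]

theorem _root_.stdSimplex.dist_center_le {v : Fin (n + 1) → stdSimplex ℝ κ} {d : ℝ}
    (h : ∀ i j, dist (v i) (v j) ≤ d) (j : Fin (n + 1)) :
    dist (center v) (v j) ≤ n / (n + 1) * d := by
  have hd : 0 ≤ d := dist_nonneg.trans (h 0 0)
  rw [dist_le_iff (by positivity)]
  intro k
  have h1 : (center v).1 k - (v j).1 k =
      ((n : ℝ) + 1)⁻¹ * ∑ i, ((v i).1 k - (v j).1 k) := by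
    rw [center, affine_val, Finset.sum_sub_distrib, mul_sub, Finset.mul_sum]
    simp only [barycenter_apply, Fintype.card_fin, Finset.sum_const, Finset.card_univ,
      nsmul_eq_mul, Nat.cast_add, Nat.cast_one]
    field_simp
  -- The term `i = j` of the sum vanishes, which is why the factor is `n / (n + 1)`.
  have h2 : ∑ i, ((v i).1 k - (v j).1 k) = ∑ i : Fin n, ((v (j.succAbove i)).1 k - (v j).1 k) := by
    rw [Fin.sum_univ_succAbove _ j, sub_self, zero_add]
  rw [h1, h2, abs_mul, abs_of_nonneg (by positivity), div_mul_eq_mul_div, inv_mul_eq_div]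
  gcongr
  calc |∑ i : Fin n, ((v (j.succAbove i)).1 k - (v j).1 k)|
      ≤ ∑ i : Fin n, |(v (j.succAbove i)).1 k - (v j).1 k| := Finset.abs_sum_le_sum_abs _ _
    _ ≤ ∑ _i : Fin n, d := Finset.sum_le_sum fun i _ => (dist_le_iff hd).1 (h _ _) k
    _ = n * d := by simp

/-- Each simplex of the subdivision of `v` lies in the hull of `v`, and its diameter is smaller by
a factor that depends only on a bound for the dimension. -/
theorem sd_single_mem (M : ℕ) {n : ℕ} (hn : n ≤ M + 1) (v : Fin n → stdSimplex ℝ κ) {d : ℝ}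
    (hv : ∀ i j, dist (v i) (v j) ≤ d) :
    sd n (single v 1) ∈ supported ℤ ℤ {w : Fin n → stdSimplex ℝ κ |
      (∀ i, w i ∈ Set.range (affine v)) ∧ ∀ i j, dist (w i) (w j) ≤ M / (M + 1) * d} := by
  induction n with
  | zero => exact single_mem_supported ℤ _ ⟨fun i => i.elim0, fun i => i.elim0⟩
  | succ n ih =>
    have hd : 0 ≤ d := dist_nonneg.trans (hv 0 0)
    rw [sd_succ_single]
    refine map_mem_of_mem_supported _ _ (S := {w | (∀ i, w i ∈ Set.range (affine v)) ∧
      ∀ i j, dist (w i) (w j) ≤ M / (M + 1) * d}) ?_ ?_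
    · rintro w ⟨hw, hw'⟩
      rw [cone_single]
      have hc : ∀ j, dist (center v) (w j) ≤ M / (M + 1) * d := by
        intro j
        obtain ⟨t, ht⟩ := hw j
        rw [← ht]
        refine dist_affine_le (by positivity) (fun i => (dist_center_le hv i).trans ?_) t
        have hnM : (n : ℝ) ≤ M := by exact_mod_cast Nat.le_of_succ_le_succ hn
        refine mul_le_mul_of_nonneg_right ?_ hd
        rw [div_le_div_iff₀ (by positivity) (by positivity)]
        nlinarith
      refine single_mem_supported ℤ _ ⟨fun i => ?_, fun i j => ?_⟩
      · refine Fin.cases ⟨_, rfl⟩ (fun i => ?_) i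
        exact hw i
      · refine Fin.cases ?_ (fun i => ?_) i <;> refine Fin.cases ?_ (fun j => ?_) j
        · rw [dist_self]; positivity
        · exact hc j
        · rw [dist_comm]; exact hc i
        · exact hw' i j
    · rw [bd_single, map_sum]
      refine Submodule.sum_mem _ fun i _ => ?_
      rw [map_zsmul]
      refine Submodule.smul_mem _ _ ?_
      refine supported_mono ?_ (ih (by lia) (v ∘ i.succAbove) fun a b => hv _ _)
      rintro w ⟨hw, hw'⟩
      exact ⟨fun j => range_affine_comp_subset _ _ (hw j), hw'⟩

theorem sd_pow_single_mem (m : ℕ) (v : Fin (n + 1) → stdSimplex ℝ κ) {d : ℝ}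
    (hv : ∀ i j, dist (v i) (v j) ≤ d) :
    (sd (n + 1) ^ m) (single v 1) ∈ supported ℤ ℤ {w : Fin (n + 1) → stdSimplex ℝ κ |
      ∀ i j, dist (w i) (w j) ≤ (n / (n + 1) : ℝ) ^ m * d} := by
  induction m with
  | zero => exact single_mem_supported ℤ _ (by simpa using hv)
  | succ m ih =>
    rw [pow_succ' (sd (n + 1)), Module.End.mul_apply]
    refine map_mem_of_mem_supported _ _ (fun w hw => ?_) ih
    refine supported_mono ?_ (sd_single_mem n le_rfl w hw)
    rintro w' ⟨-, hw'⟩ i j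
    rw [pow_succ', mul_assoc]
    exact hw' i j

/-- For every open cover of the simplex, all simplices of a sufficiently fine iterated subdivision
are subordinate to the cover. -/
theorem eventually_sd_pow_mem {ι : Type*} {c : ι → Set (stdSimplex ℝ κ)}
    (hc : ∀ i, IsOpen (c i)) (hcov : ∀ x, ∃ i, x ∈ c i) (v : Fin (n + 1) → stdSimplex ℝ κ) :
    ∀ᶠ m in Filter.atTop, (sd (n + 1) ^ m) (single v 1) ∈
      supported ℤ ℤ {w : Fin (n + 1) → stdSimplex ℝ κ | ∃ i, Set.range (affine w) ⊆ c i} := by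
  obtain ⟨δ, hδ, hL⟩ := lebesgue_number_lemma_of_metric (isCompact_univ (X := stdSimplex ℝ κ)) hc
    (fun x _ => Set.mem_iUnion.2 (hcov x))
  obtain ⟨d, hd⟩ := (Metric.isBounded_iff (α := stdSimplex ℝ κ)).1
    (isCompact_univ (X := stdSimplex ℝ κ)).isBounded
  have hlim : Filter.Tendsto (fun m : ℕ => (n / (n + 1) : ℝ) ^ m * d) Filter.atTop (nhds 0) := by
    have := tendsto_pow_atTop_nhds_zero_of_lt_one (r := (n / (n + 1) : ℝ)) (by positivity)
      (by rw [div_lt_one (by positivity)]; linarith)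
    simpa using this.mul_const d
  filter_upwards [hlim.eventually (gt_mem_nhds hδ)] with m hm
  refine supported_mono ?_ (sd_pow_single_mem m v fun i j => hd trivial trivial)
  intro w hw
  obtain ⟨i, hi⟩ := hL (w 0) trivial
  refine ⟨i, ?_⟩
  rintro _ ⟨t, rfl⟩
  refine hi ?_
  rw [Metric.mem_ball, dist_comm]
  exact (dist_affine_le (dist_nonneg.trans (hw 0 0)) (hw 0) t).trans_lt hm

end Subdivision

end TupleChain

end

section

/-! ### Chains of a simplicial set -/

open CategoryTheory Simplicial Opposite

/-- The integral chain complex of a simplicial set, as a functor. -/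
noncomputable def SSet.intChains : SSet.{u} ⥤ ChainComplex (ModuleCat.{u} ℤ) ℕ :=
  (SimplicialObject.whiskering (Type u) (ModuleCat.{u} ℤ)).obj CechClosure.freeAbelian.{u} ⋙
    AlgebraicTopology.alternatingFaceMapComplex (ModuleCat.{u} ℤ)

namespace SSet

variable {K L : SSet.{u}}

/-- The boundary on the free abelian groups underlying `SSet.intChains`. -/
noncomputable def intBd (K : SSet.{u}) (n : ℕ) : (K _⦋n + 1⦌ →₀ ℤ) →ₗ[ℤ] (K _⦋n⦌ →₀ ℤ) :=
  ∑ i : Fin (n + 2), (-1 : ℤ) ^ (i : ℕ) • Finsupp.lmapDomain ℤ ℤ (K.δ i)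

theorem intChains_d (n : ℕ) :
    (intChains.obj K).d (n + 1) n = ModuleCat.ofHom (intBd K n) := by
  change ((AlgebraicTopology.alternatingFaceMapComplex _).obj _).d (n + 1) n = _
  rw [AlgebraicTopology.alternatingFaceMapComplex_obj_d]
  refine ModuleCat.hom_ext ?_
  rw [AlgebraicTopology.AlternatingFaceMapComplex.objD, ModuleCat.hom_sum]
  rfl

theorem intChains_map_f (f : K ⟶ L) (n : ℕ) :
    (intChains.map f).f n = ModuleCat.ofHom (Finsupp.lmapDomain ℤ ℤ (f.app (op ⦋n⦌))) :=
  rfl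

end SSet

/-! ### Homology isomorphisms in terms of elements -/

section Homology

variable {R : Type*} [Ring R] {K L : ChainComplex (ModuleCat.{u} R) ℕ}

open HomologicalComplex

theorem ChainComplex.exists_cycles_of_d_eq_zero {n : ℕ} (x : K.X (n + 1))
    (hx : K.d (n + 1) n x = 0) : ∃ z : K.cycles (n + 1), K.iCycles (n + 1) z = x :=
  (ShortComplex.moduleCat_exact_iff _).1 (ShortComplex.exact_of_f_is_kernel
    (ShortComplex.mk (K.iCycles (n + 1)) (K.d (n + 1) n) (K.iCycles_d _ _))
    (K.cyclesIsKernel (n + 1) n (by simp))) x hx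

theorem ChainComplex.homologyπ_eq_zero_iff {n : ℕ} (z : K.cycles n) :
    K.homologyπ n z = 0 ↔ ∃ w : K.X (n + 1), K.d (n + 1) n w = K.iCycles n z := by
  have hi : ∀ w, K.iCycles n (K.toCycles (n + 1) n w) = K.d (n + 1) n w := fun w =>
    ConcreteCategory.congr_hom (K.toCycles_i (n + 1) n) w
  constructor
  · intro h
    obtain ⟨w, hw⟩ := (ShortComplex.moduleCat_exact_iff _).1 (ShortComplex.exact_of_g_is_cokernel
      (ShortComplex.mk (K.toCycles (n + 1) n) (K.homologyπ n) (K.toCycles_comp_homologyπ _ _))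
      (K.homologyIsCokernel (n + 1) n (by simp))) z h
    exact ⟨w, by rw [← hi, ← hw]⟩
  · rintro ⟨w, hw⟩
    have h : z = K.toCycles (n + 1) n w :=
      (ModuleCat.mono_iff_injective (K.iCycles n)).1 inferInstance (by rw [hi, hw])
    rw [h]
    exact ConcreteCategory.congr_hom (K.toCycles_comp_homologyπ (n + 1) n) w

/-- A chain map is an isomorphism on homology as soon as every cycle of the target is homologous
to the image of a cycle, and every cycle whose image bounds is itself a boundary. -/
theorem ChainComplex.isIso_homologyMap_of_elements (f : K ⟶ L) (n : ℕ)
    (hsurj : ∀ y : L.X (n + 1), L.d (n + 1) n y = 0 → ∃ x : K.X (n + 1), K.d (n + 1) n x = 0 ∧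
      ∃ w, L.d (n + 2) (n + 1) w = y - f.f (n + 1) x)
    (hinj : ∀ (x : K.X (n + 1)) (w : L.X (n + 2)), L.d (n + 2) (n + 1) w = f.f (n + 1) x →
      ∃ w', K.d (n + 2) (n + 1) w' = x) :
    IsIso (homologyMap f (n + 1)) := by
  have hi : ∀ z, L.iCycles (n + 1) (cyclesMap f (n + 1) z) = f.f (n + 1) (K.iCycles (n + 1) z) :=
    fun z => ConcreteCategory.congr_hom (cyclesMap_i f (n + 1)) z
  have hπ : ∀ z, homologyMap f (n + 1) (K.homologyπ (n + 1) z) =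
      L.homologyπ (n + 1) (cyclesMap f (n + 1) z) :=
    fun z => ConcreteCategory.congr_hom (homologyπ_naturality f (n + 1)) z
  have hK := (ModuleCat.epi_iff_surjective (K.homologyπ (n + 1))).1 inferInstance
  have hL := (ModuleCat.epi_iff_surjective (L.homologyπ (n + 1))).1 inferInstance
  rw [ConcreteCategory.isIso_iff_bijective]
  constructor
  · rw [injective_iff_map_eq_zero]
    intro a ha
    obtain ⟨z, rfl⟩ := hK a
    rw [hπ, homologyπ_eq_zero_iff] at ha
    obtain ⟨w, hw⟩ := ha
    rw [homologyπ_eq_zero_iff]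
    exact hinj _ w (hw.trans (hi z))
  · intro b
    obtain ⟨y, rfl⟩ := hL b
    obtain ⟨x, hx, w, hw⟩ := hsurj (L.iCycles (n + 1) y)
      (ConcreteCategory.congr_hom (L.iCycles_d (n + 1) n) y)
    obtain ⟨z, rfl⟩ := exists_cycles_of_d_eq_zero x hx
    refine ⟨K.homologyπ (n + 1) z, ?_⟩
    rw [hπ, eq_comm, ← sub_eq_zero, ← map_sub, homologyπ_eq_zero_iff]
    exact ⟨w, by rw [hw, map_sub, hi]⟩

end Homology

/-! ### Subdivision of singular chains -/

namespace CechClosure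

open Finsupp

theorem _root_.Finsupp.mem_supported_iff_exists {α : Type*} {S : Set α} {y : α →₀ ℤ} :
    y ∈ supported ℤ ℤ S ↔ ∃ x, lmapDomain ℤ ℤ (Subtype.val : S → α) x = y := by
  constructor
  · intro hy
    refine ⟨comapDomain Subtype.val y Subtype.val_injective.injOn, ?_⟩
    refine mapDomain_comapDomain _ Subtype.val_injective y ?_
    rw [Subtype.range_coe]
    exact hy
  · rintro ⟨x, rfl⟩
    refine map_mem_of_mem_supported _ _ (S := Set.univ) (fun v _ => ?_) (by simp)
    rw [lmapDomain_apply, mapDomain_single]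
    exact single_mem_supported ℤ _ v.2

variable {X : Type u} {c : CechClosure X} {m n k : ℕ}

/-- Restriction of a singular simplex along the affine map with given vertices. -/
noncomputable def SingularSimplex.lin (σ : c.SingularSimplex n)
    (v : Fin (m + 1) → stdSimplex ℝ (Fin (n + 1))) : c.SingularSimplex m :=
  ⟨σ.1 ∘ stdSimplex.affine v, σ.2.comp (isContinuous_ofTopology (stdSimplex.continuous_affine v))⟩

theorem SingularSimplex.lin_lin (σ : c.SingularSimplex n)
    (v : Fin (m + 1) → stdSimplex ℝ (Fin (n + 1)))
    (w : Fin (k + 1) → stdSimplex ℝ (Fin (m + 1))) :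
    (σ.lin v).lin w = σ.lin (stdSimplex.affine v ∘ w) :=
  Subtype.ext (funext fun t => congrArg σ.1 (stdSimplex.affine_affine v w t))

theorem SingularSimplex.lin_vertex (σ : c.SingularSimplex n) :
    σ.lin stdSimplex.vertex = σ :=
  Subtype.ext (funext fun t => congrArg σ.1 (stdSimplex.affine_vertices t))

theorem SingularSimplex.pullback_lin (σ : c.SingularSimplex n)
    (v : Fin (m + 1) → stdSimplex ℝ (Fin (n + 1))) (f : Fin (k + 1) → Fin (m + 1)) :
    (σ.lin v).pullback f = σ.lin (v ∘ f) :=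
  Subtype.ext (funext fun t => congrArg σ.1 (stdSimplex.affine_map v f t))

/-- The boundary of singular chains. -/
noncomputable def bd (c : CechClosure X) (n : ℕ) :
    (c.SingularSimplex (n + 1) →₀ ℤ) →ₗ[ℤ] (c.SingularSimplex n →₀ ℤ) :=
  ∑ i : Fin (n + 2), (-1 : ℤ) ^ (i : ℕ) •
    lmapDomain ℤ ℤ (SingularSimplex.pullback i.succAbove)

theorem bd_single (σ : c.SingularSimplex (n + 1)) (a : ℤ) :
    c.bd n (single σ a) =
      ∑ i : Fin (n + 2), (-1 : ℤ) ^ (i : ℕ) • single (σ.pullback i.succAbove) a := by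
  simp only [bd, LinearMap.sum_apply, LinearMap.smul_apply, lmapDomain_apply, mapDomain_single]

/-- The map from affine chains in a simplex to singular chains given by a singular simplex. -/
noncomputable def push (σ : c.SingularSimplex n) :
    TupleChain (stdSimplex ℝ (Fin (n + 1))) (k + 1) →ₗ[ℤ] (c.SingularSimplex k →₀ ℤ) :=
  lmapDomain ℤ ℤ σ.lin

theorem push_single (σ : c.SingularSimplex n)
    (v : Fin (k + 1) → stdSimplex ℝ (Fin (n + 1))) (a : ℤ) :
    push σ (single v a) = single (σ.lin v) a := by
  simp only [push, lmapDomain_apply, mapDomain_single]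

theorem push_bd (σ : c.SingularSimplex n)
    (x : TupleChain (stdSimplex ℝ (Fin (n + 1))) (k + 2)) :
    push σ (TupleChain.bd x) = c.bd k (push σ x) := by
  refine LinearMap.congr_fun (f := push σ ∘ₗ TupleChain.bd) (g := c.bd k ∘ₗ push σ)
    (TupleChain.hom_ext fun v => ?_) x
  rw [LinearMap.comp_apply, LinearMap.comp_apply, TupleChain.bd_single, map_sum, push_single,
    bd_single]
  refine Finset.sum_congr rfl fun i _ => ?_
  rw [map_zsmul, push_single, ← SingularSimplex.pullback_lin]

theorem push_lin (σ : c.SingularSimplex n) (v : Fin (m + 1) → stdSimplex ℝ (Fin (n + 1)))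
    (x : TupleChain (stdSimplex ℝ (Fin (m + 1))) (k + 1)) :
    push (σ.lin v) x = push σ (TupleChain.map (stdSimplex.affine v) x) := by
  refine LinearMap.congr_fun (f := push (σ.lin v))
    (g := push σ ∘ₗ TupleChain.map (stdSimplex.affine v)) (TupleChain.hom_ext fun w => ?_) x
  rw [LinearMap.comp_apply, TupleChain.map_single, push_single, push_single,
    SingularSimplex.lin_lin]

/-- The tautological affine chain of the standard simplex. -/
noncomputable def fundamental (n : ℕ) : TupleChain (stdSimplex ℝ (Fin (n + 1))) (n + 1) :=
  single stdSimplex.vertex 1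

theorem push_fundamental (σ : c.SingularSimplex n) : push σ (fundamental n) = single σ 1 := by
  rw [fundamental, push_single, SingularSimplex.lin_vertex]

/-- The operation on singular chains defined by a family of operations on affine chains of
standard simplices: apply it to the tautological chain and push the result forward. -/
noncomputable def transfer (c : CechClosure X)
    (P : ∀ m, TupleChain (stdSimplex ℝ (Fin (m + 1))) (n + 1) →ₗ[ℤ]
      TupleChain (stdSimplex ℝ (Fin (m + 1))) (k + 1)) :
    (c.SingularSimplex n →₀ ℤ) →ₗ[ℤ] (c.SingularSimplex k →₀ ℤ) :=
  linearCombination ℤ fun σ => push σ (P n (fundamental n))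

theorem transfer_single
    (P : ∀ m, TupleChain (stdSimplex ℝ (Fin (m + 1))) (n + 1) →ₗ[ℤ]
      TupleChain (stdSimplex ℝ (Fin (m + 1))) (k + 1)) (σ : c.SingularSimplex n) :
    c.transfer P (single σ 1) = push σ (P n (fundamental n)) := by
  simp [transfer]

theorem push_transfer
    {P : ∀ m, TupleChain (stdSimplex ℝ (Fin (m + 1))) (n + 1) →ₗ[ℤ]
      TupleChain (stdSimplex ℝ (Fin (m + 1))) (k + 1)}
    (hP : ∀ (m l : ℕ) (w : Fin (m + 1) → stdSimplex ℝ (Fin (l + 1))) x,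
      TupleChain.map (stdSimplex.affine w) (P m x) = P l (TupleChain.map (stdSimplex.affine w) x))
    (σ : c.SingularSimplex m) (x : TupleChain (stdSimplex ℝ (Fin (m + 1))) (n + 1)) :
    c.transfer P (push σ x) = push σ (P m x) := by
  refine LinearMap.congr_fun (f := c.transfer P ∘ₗ push σ)
    (g := push σ ∘ₗ P m) (TupleChain.hom_ext fun v => ?_) x
  rw [LinearMap.comp_apply, LinearMap.comp_apply, push_single, transfer_single, push_lin, hP,
    fundamental, TupleChain.map_single]
  have h : stdSimplex.affine v ∘ stdSimplex.vertex = v :=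
    funext fun i => stdSimplex.affine_vertex v i
  rw [h]

/-- The `m`-fold barycentric subdivision of singular chains. -/
noncomputable def sdChain (c : CechClosure X) (m n : ℕ) :
    (c.SingularSimplex n →₀ ℤ) →ₗ[ℤ] (c.SingularSimplex n →₀ ℤ) :=
  c.transfer fun _ => TupleChain.sd (n + 1) ^ m

/-- The chain homotopy between the identity and the `m`-fold barycentric subdivision. -/
noncomputable def sdChainHomotopy (c : CechClosure X) (m n : ℕ) :
    (c.SingularSimplex n →₀ ℤ) →ₗ[ℤ] (c.SingularSimplex (n + 1) →₀ ℤ) :=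
  c.transfer fun _ => TupleChain.sdPowHomotopy m (n + 1)

theorem bd_sdChain (m n : ℕ) (x : c.SingularSimplex (n + 1) →₀ ℤ) :
    c.bd n (c.sdChain m (n + 1) x) =
      c.sdChain m n (c.bd n x) := by
  refine LinearMap.congr_fun (f := c.bd n ∘ₗ c.sdChain m (n + 1))
    (g := c.sdChain m n ∘ₗ c.bd n)
    (Finsupp.lhom_ext' fun σ => LinearMap.ext_ring ?_) x
  simp only [LinearMap.comp_apply, lsingle_apply]
  rw [sdChain, sdChain, transfer_single, ← push_bd, TupleChain.bd_sd_pow]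
  conv_rhs => rw [← push_fundamental, ← push_bd]
  rw [push_transfer fun _ _ => TupleChain.map_sd_pow m]

theorem bd_sdChainHomotopy (m n : ℕ) (x : c.SingularSimplex (n + 1) →₀ ℤ) :
    c.bd (n + 1) (c.sdChainHomotopy m (n + 1) x) +
      c.sdChainHomotopy m n (c.bd n x) = x - c.sdChain m (n + 1) x := by
  refine LinearMap.congr_fun
    (f := c.bd (n + 1) ∘ₗ c.sdChainHomotopy m (n + 1) +
      c.sdChainHomotopy m n ∘ₗ c.bd n)
    (g := LinearMap.id - c.sdChain m (n + 1))
    (Finsupp.lhom_ext' fun σ => LinearMap.ext_ring ?_) x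
  simp only [LinearMap.comp_apply, lsingle_apply, LinearMap.add_apply, LinearMap.sub_apply,
    LinearMap.id_apply]
  have hσ : c.bd n (single σ 1) = push σ (TupleChain.bd (fundamental (n + 1))) := by
    rw [push_bd, push_fundamental]
  rw [sdChain, sdChainHomotopy, sdChainHomotopy, transfer_single, transfer_single, ← push_bd, hσ,
    push_transfer fun _ _ => TupleChain.map_sdPowHomotopy m, ← push_fundamental σ, ← map_add,
    ← map_sub, TupleChain.bd_sdPowHomotopy]

theorem eventually_sdChain_mem {S : Set (c.SingularSimplex n)}
    (hS : ∀ σ : c.SingularSimplex n, ∀ᶠ m in Filter.atTop,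
      (TupleChain.sd (n + 1) ^ m) (fundamental n) ∈ supported ℤ ℤ {v | σ.lin v ∈ S})
    (x : c.SingularSimplex n →₀ ℤ) :
    ∀ᶠ m in Filter.atTop, c.sdChain m n x ∈ supported ℤ ℤ S := by
  induction x using Finsupp.induction_linear with
  | zero => simp
  | add x y hx hy =>
    filter_upwards [hx, hy] with m hx hy
    rw [map_add]
    exact Submodule.add_mem _ hx hy
  | single σ a =>
    filter_upwards [hS σ] with m hm
    rw [← smul_single_one, map_smul, sdChain, transfer_single]
    refine Submodule.smul_mem _ _ (map_mem_of_mem_supported _ _ (fun v hv => ?_) hm)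
    rw [push_single]
    exact single_mem_supported ℤ _ hv

theorem sdChainHomotopy_mem {S : Set (c.SingularSimplex n)} {S' : Set (c.SingularSimplex (n + 1))}
    (hS : ∀ σ ∈ S, ∀ v, σ.lin v ∈ S') (m : ℕ) {x : c.SingularSimplex n →₀ ℤ}
    (hx : x ∈ supported ℤ ℤ S) : c.sdChainHomotopy m n x ∈ supported ℤ ℤ S' := by
  refine map_mem_of_mem_supported _ _ (fun σ hσ => ?_) hx
  rw [sdChainHomotopy, transfer_single]
  refine map_mem_of_mem_supported _ _ (S := Set.univ) (fun v _ => ?_) (by simp)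
  rw [push_single]
  exact single_mem_supported ℤ _ (hS σ hσ v)

/-- The homology of a subcomplex of singular simplices agrees with the whole singular homology if
the subcomplex is stable under affine restrictions and contains all simplices of a sufficiently
fine subdivision of any given singular simplex. -/
theorem isIso_homologyMap_subcomplex (A : c.singularSet.Subcomplex)
    (hlin : ∀ (n k : ℕ) (σ : c.SingularSimplex n), σ ∈ A.obj (op ⦋n⦌) →
      ∀ v : Fin (k + 1) → stdSimplex ℝ (Fin (n + 1)), σ.lin v ∈ A.obj (op ⦋k⦌))
    (hsmall : ∀ (n : ℕ) (σ : c.SingularSimplex n), ∀ᶠ m in Filter.atTop,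
      (TupleChain.sd (n + 1) ^ m) (fundamental n) ∈
        supported ℤ ℤ {v | σ.lin v ∈ A.obj (op ⦋n⦌)}) (n : ℕ) :
    IsIso (HomologicalComplex.homologyMap (SSet.intChains.map A.ι) (n + 1)) := by
  let S : ∀ k, Set (c.SingularSimplex k) := fun k => A.obj (op ⦋k⦌)
  let inc : ∀ k, (S k →₀ ℤ) →ₗ[ℤ] (c.SingularSimplex k →₀ ℤ) :=
    fun k => lmapDomain ℤ ℤ Subtype.val
  have hinc : ∀ k, Function.Injective (inc k) := fun k =>
    mapDomain_injective Subtype.val_injective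
  have hbd : ∀ k x, c.bd k (inc (k + 1) x) = inc k (SSet.intBd A.toSSet k x) := by
    intro k x
    have h := ConcreteCategory.congr_hom ((SSet.intChains.map A.ι).comm (k + 1) k) x
    rw [SSet.intChains_d, SSet.intChains_d] at h
    exact h
  refine ChainComplex.isIso_homologyMap_of_elements _ n ?_ ?_
  · rw [SSet.intChains_d, SSet.intChains_d, SSet.intChains_d]
    intro (y : c.SingularSimplex (n + 1) →₀ ℤ) (hy : c.bd n y = 0)
    obtain ⟨m, hm⟩ := (eventually_sdChain_mem (hsmall (n + 1)) y).exists
    obtain ⟨x, hx⟩ := mem_supported_iff_exists.1 hm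
    change inc (n + 1) x = _ at hx
    refine ⟨x, ?_, c.sdChainHomotopy m (n + 1) y, ?_⟩
    · refine hinc n ?_
      change inc n (SSet.intBd A.toSSet n x) = inc n 0
      rw [← hbd, hx, bd_sdChain, hy, map_zero, map_zero]
    · change c.bd (n + 1) (c.sdChainHomotopy m (n + 1) y) = y - inc (n + 1) x
      rw [hx, ← bd_sdChainHomotopy, hy, map_zero, add_zero]
  · rw [SSet.intChains_d, SSet.intChains_d]
    intro (x : S (n + 1) →₀ ℤ) (w : c.SingularSimplex (n + 2) →₀ ℤ)
      (hw : c.bd (n + 1) w = inc (n + 1) x)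
    obtain ⟨m, hm⟩ := (eventually_sdChain_mem (hsmall (n + 2)) w).exists
    obtain ⟨w₁, hw₁⟩ := mem_supported_iff_exists.1 hm
    obtain ⟨w₂, hw₂⟩ := mem_supported_iff_exists.1 (sdChainHomotopy_mem
      (hlin (n + 1) (n + 2)) m (mem_supported_iff_exists.2 ⟨x, rfl⟩))
    change inc (n + 2) w₁ = _ at hw₁
    change inc (n + 2) w₂ = c.sdChainHomotopy m (n + 1) (inc (n + 1) x) at hw₂
    refine ⟨(w₁ + w₂ : S (n + 2) →₀ ℤ), hinc _ ?_⟩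
    have h0 : c.bd n (inc (n + 1) x) = 0 := by
      rw [← hw]
      have h := ConcreteCategory.congr_hom
        ((SSet.intChains.obj c.singularSet).d_comp_d (n + 2) (n + 1) n) w
      rw [SSet.intChains_d, SSet.intChains_d] at h
      exact h
    have h1 := c.bd_sdChainHomotopy m n (inc (n + 1) x)
    rw [h0, map_zero, add_zero] at h1
    refine (hbd (n + 1) (w₁ + w₂)).symm.trans ?_
    rw [map_add, map_add, hw₁, hw₂, bd_sdChain, hw, h1, add_sub_cancel]

end CechClosure

end

section

open CategoryTheory Limits Simplicial Opposite

/-! ### The Mayer–Vietoris sequence of two subcomplexes -/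

section Biprod

open HomologicalComplex

variable {R : Type*} [Ring R] {ι : Type*} {c : ComplexShape ι}
  {K₀ K₁ K₂ K₃ : HomologicalComplex (ModuleCat.{u} R) c}

/-- A commutative square of complexes of modules that is bicartesian in each degree gives a short
exact sequence. -/
theorem HomologicalComplex.shortExact_of_square {i : K₀ ⟶ K₁} {j : K₀ ⟶ K₂} {p : K₁ ⟶ K₃}
    {q : K₂ ⟶ K₃} (w : biprod.lift i j ≫ biprod.desc p (-q) = 0)
    (hi : ∀ n, Function.Injective (i.f n))
    (hex : ∀ n a b, p.f n a = q.f n b → ∃ z, i.f n z = a ∧ j.f n z = b)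
    (hsurj : ∀ n x, ∃ a b, p.f n a + q.f n b = x) :
    (ShortComplex.mk _ _ w).ShortExact := by
  refine shortExact_of_degreewise_shortExact _ fun n => ?_
  have hfst (z : K₀.X n) : (biprod.fst : K₁ ⊞ K₂ ⟶ _).f n ((biprod.lift i j).f n z) = i.f n z :=
    ConcreteCategory.congr_hom (congr_hom (biprod.lift_fst i j) n) z
  have hsnd (z : K₀.X n) : (biprod.snd : K₁ ⊞ K₂ ⟶ _).f n ((biprod.lift i j).f n z) = j.f n z :=
    ConcreteCategory.congr_hom (congr_hom (biprod.lift_snd i j) n) z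
  have hinl (a : K₁.X n) :
      (biprod.desc p (-q)).f n ((biprod.inl : _ ⟶ K₁ ⊞ K₂).f n a) = p.f n a :=
    ConcreteCategory.congr_hom (congr_hom (biprod.inl_desc p (-q)) n) a
  have hinr (b : K₂.X n) :
      (biprod.desc p (-q)).f n ((biprod.inr : _ ⟶ K₁ ⊞ K₂).f n b) = -q.f n b :=
    ConcreteCategory.congr_hom (congr_hom (biprod.inr_desc p (-q)) n) b
  have htotal (x : (K₁ ⊞ K₂).X n) :
      (biprod.inl : _ ⟶ K₁ ⊞ K₂).f n ((biprod.fst : K₁ ⊞ K₂ ⟶ _).f n x) +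
        (biprod.inr : _ ⟶ K₁ ⊞ K₂).f n ((biprod.snd : K₁ ⊞ K₂ ⟶ _).f n x) = x :=
    ConcreteCategory.congr_hom (congr_hom (biprod.total (X := K₁) (Y := K₂)) n) x
  apply ModuleCat.shortComplex_shortExact
  · intro (x : (K₁ ⊞ K₂).X n)
    change (biprod.desc p (-q)).f n x = 0 ↔ ∃ z, (biprod.lift i j).f n z = x
    constructor
    · intro hx
      rw [← htotal x, map_add, hinl, hinr, ← sub_eq_add_neg, sub_eq_zero] at hx
      obtain ⟨z, hz, hz'⟩ := hex _ _ _ hx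
      refine ⟨z, ?_⟩
      rw [← htotal x, ← hz, ← hz', ← hfst, ← hsnd, htotal]
    · rintro ⟨z, rfl⟩
      exact ConcreteCategory.congr_hom (congr_hom w n) z
  · intro (x : K₀.X n) (y : K₀.X n)
      (hxy : (biprod.lift i j).f n x = (biprod.lift i j).f n y)
    refine hi n ?_
    rw [← hfst, ← hfst, hxy]
  · intro (x : K₃.X n)
    obtain ⟨a, b, rfl⟩ := hsurj _ x
    refine ⟨(biprod.inl : _ ⟶ K₁ ⊞ K₂).f n a - (biprod.inr : _ ⟶ K₁ ⊞ K₂).f n b, ?_⟩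
    change (biprod.desc p (-q)).f n ((biprod.inl : _ ⟶ K₁ ⊞ K₂).f n a - _) = _
    rw [map_sub, hinl, hinr, sub_neg_eq_add]

theorem HomologicalComplex.isZero_homology_biprod {n : ι} (h₁ : IsZero (K₁.homology n))
    (h₂ : IsZero (K₂.homology n)) : IsZero ((K₁ ⊞ K₂).homology n) := by
  rw [IsZero.iff_id_eq_zero, ← homologyMap_id, ← biprod.total, homologyMap_add, homologyMap_comp,
    homologyMap_comp, h₁.eq_zero_of_tgt (homologyMap biprod.fst n),
    h₂.eq_zero_of_tgt (homologyMap biprod.snd n), zero_comp, zero_comp, add_zero]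

end Biprod

namespace SSet

variable {K : SSet.{u}}

open Subcomplex HomologicalComplex

theorem injective_intChains_ι (A : K.Subcomplex) (n : ℕ) :
    Function.Injective ((intChains.map A.ι).f n) := by
  rw [intChains_map_f]
  exact Finsupp.mapDomain_injective Subtype.val_injective

theorem mem_supported_iff_exists_intChains {A : K.Subcomplex} {n : ℕ}
    {y : K _⦋n⦌ →₀ ℤ} :
    y ∈ Finsupp.supported ℤ ℤ (A.obj (op ⦋n⦌)) ↔ ∃ x, (intChains.map A.ι).f n x = y :=
  Finsupp.mem_supported_iff_exists

theorem intChains_homOfLE_ι {A B : K.Subcomplex} (h : A ≤ B) {n : ℕ}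
    (x : (intChains.obj (A : SSet)).X n) :
    (intChains.map B.ι).f n ((intChains.map (homOfLE h)).f n x) = (intChains.map A.ι).f n x :=
  ConcreteCategory.congr_hom (congr_hom (intChains.map_comp (homOfLE h) B.ι) n).symm x

/-- If two subcomplexes are acyclic in degrees at least `n`, the connecting homomorphism of the
Mayer–Vietoris sequence is an isomorphism from degree `n + 1` to degree `n`. -/
theorem nonempty_mayerVietorisIso (A B : K.Subcomplex) (n : ℕ)
    (hA : ∀ m, n ≤ m → IsZero ((intChains.obj (A : SSet)).homology m))
    (hB : ∀ m, n ≤ m → IsZero ((intChains.obj (B : SSet)).homology m)) :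
    Nonempty ((intChains.obj ((A ⊔ B : K.Subcomplex) : SSet)).homology (n + 1) ≅
      (intChains.obj ((A ⊓ B : K.Subcomplex) : SSet)).homology n) := by
  have w : biprod.lift (intChains.map (homOfLE (inf_le_left : A ⊓ B ≤ A)))
      (intChains.map (homOfLE (inf_le_right : A ⊓ B ≤ B))) ≫
      biprod.desc (intChains.map (homOfLE (le_sup_left : A ≤ A ⊔ B)))
        (-intChains.map (homOfLE (le_sup_right : B ≤ A ⊔ B))) = 0 := by
    rw [biprod.lift_desc, Preadditive.comp_neg, ← Functor.map_comp, ← Functor.map_comp]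
    exact add_neg_cancel _
  have hS : (ShortComplex.mk _ _ w).ShortExact := by
    refine shortExact_of_square w (fun k x y hxy => ?_) (fun k a b hab => ?_) fun k x => ?_
    · refine injective_intChains_ι _ k ?_
      rw [← intChains_homOfLE_ι inf_le_left, hxy, intChains_homOfLE_ι]
    · have h : (intChains.map A.ι).f k a = (intChains.map B.ι).f k b := by
        rw [← intChains_homOfLE_ι le_sup_left, hab, intChains_homOfLE_ι]
      have hmem : (intChains.map A.ι).f k a ∈
          Finsupp.supported ℤ ℤ (A.obj (op ⦋k⦌) ∩ B.obj (op ⦋k⦌)) := by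
        rw [Finsupp.supported_inter]
        exact ⟨mem_supported_iff_exists_intChains.2 ⟨a, rfl⟩,
          mem_supported_iff_exists_intChains.2 ⟨b, h.symm⟩⟩
      obtain ⟨z, hz⟩ := (mem_supported_iff_exists_intChains (A := A ⊓ B)).1 hmem
      refine ⟨z, injective_intChains_ι A k ?_, injective_intChains_ι B k ?_⟩
      · rw [intChains_homOfLE_ι, hz]
      · rw [intChains_homOfLE_ι, hz, h]
    · have hmem : (intChains.map (A ⊔ B).ι).f k x ∈
          Finsupp.supported ℤ ℤ (A.obj (op ⦋k⦌) ∪ B.obj (op ⦋k⦌)) :=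
        (mem_supported_iff_exists_intChains (A := A ⊔ B)).2 ⟨x, rfl⟩
      have hsum : ∀ v ∈ Finsupp.supported ℤ ℤ (A.obj (op ⦋k⦌) ∪ B.obj (op ⦋k⦌)),
          ∃ y ∈ Finsupp.supported ℤ ℤ (A.obj (op ⦋k⦌)),
            ∃ z ∈ Finsupp.supported ℤ ℤ (B.obj (op ⦋k⦌)), y + z = v := fun v hv => by
        rwa [Finsupp.supported_union, Submodule.mem_sup] at hv
      obtain ⟨y, hy, z, hz, hyz⟩ := hsum _ hmem
      obtain ⟨a, rfl⟩ := mem_supported_iff_exists_intChains.1 hy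
      obtain ⟨b, rfl⟩ := mem_supported_iff_exists_intChains.1 hz
      refine ⟨a, b, injective_intChains_ι (A ⊔ B) k ?_⟩
      rw [map_add, intChains_homOfLE_ι, intChains_homOfLE_ι]
      exact hyz
  exact ⟨hS.δIso (n + 1) n (by simp)
    (isZero_homology_biprod (hA _ n.le_succ) (hB _ n.le_succ))
    (isZero_homology_biprod (hA _ le_rfl) (hB _ le_rfl))⟩

end SSet

end

section

open CategoryTheory Limits Simplicial Opposite Filter Topology MonoidalCategory
  CartesianMonoidalCategory

/-! ### Homotopy invariance -/

namespace SSet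

/-- Homotopic maps of simplicial sets agree on integral homology. -/
theorem Homotopy.homologyMap_intChains_eq {K L : SSet.{u}} {f g : K ⟶ L} (H : Homotopy f g)
    (n : ℕ) : HomologicalComplex.homologyMap (intChains.map f) n =
      HomologicalComplex.homologyMap (intChains.map g) n :=
  (SimplicialObject.Homotopy.toChainHomotopy
    (H.toSimplicialObjectHomotopy.whiskerRight CechClosure.freeAbelian)).homologyMap_eq n

/-- A constant simplicial set has no homology in positive degrees. -/
theorem isZero_homology_intChains_const (E : Type u) {n : ℕ} (hn : n ≠ 0) :
    IsZero ((intChains.obj ((SimplicialObject.const (Type u)).obj E)).homology n) := by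
  let e : intChains.obj ((SimplicialObject.const (Type u)).obj E) ≅
      ChainComplex.alternatingConst.obj (CechClosure.freeAbelian.obj E) :=
    (AlgebraicTopology.alternatingFaceMapComplex _).mapIso (Functor.constComp _ _ _) ≪≫
      AlgebraicTopology.alternatingFaceMapComplexConst.app _
  exact ((ChainComplex.alternatingConst_exactAt _ n hn).of_iso e.symm).isZero_homology

end SSet

namespace CechClosure

variable {X : Type u} {Y : Type u} {c : CechClosure X} {d : CechClosure Y}

theorem pure_le_nhd (c : CechClosure X) (x : X) : pure x ≤ c.nhd x :=
  fun _ hV => IsNhd.mem (c := c) hV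

/-- The singular simplices with image in a given set of points. -/
noncomputable def simplicesIn (c : CechClosure X) (A : Set X) : c.singularSet.Subcomplex where
  obj n := {σ | ∀ t, (σ : c.SingularSimplex n.unop.len).1 t ∈ A}
  map f _ hσ := fun t => hσ (stdSimplex.map f.unop t)

theorem isContinuous_of_tendsto {n : ℕ} {f : stdSimplex ℝ (Fin (n + 1)) → X}
    (hf : ∀ t, Tendsto f (𝓝 t) (c.nhd (f t))) : (ofTopology _).IsContinuous c f :=
  isContinuous_iff_tendsto.2 fun t => by rw [nhd_ofTopology]; exact hf t

theorem SingularSimplex.tendsto {n : ℕ} (σ : c.SingularSimplex n)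
    (t : stdSimplex ℝ (Fin (n + 1))) : Tendsto σ.1 (𝓝 t) (c.nhd (σ.1 t)) := by
  rw [← nhd_ofTopology]
  exact isContinuous_iff_tendsto.1 σ.2 t

/-- The map on singular simplices in `A` induced by a map that is continuous at the points
of `A`. -/
noncomputable def mapOn {A : Set X} {B : Set Y} (f : X → Y)
    (hf : ∀ x ∈ A, Tendsto f (c.nhd x) (d.nhd (f x))) (hAB : Set.MapsTo f A B) :
    (c.simplicesIn A : SSet.{u}) ⟶ (d.simplicesIn B : SSet.{u}) where
  app _ := TypeCat.ofHom fun σ =>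
    ⟨⟨f ∘ σ.1.1, isContinuous_of_tendsto fun t =>
      (hf _ (σ.2 t)).comp (SingularSimplex.tendsto σ.1 t)⟩, fun t => hAB (σ.2 t)⟩
  naturality _ _ _ := rfl

/-- The coordinate of a point of a simplex along a map of its vertex set to `{0, 1}`. -/
noncomputable def simplexParam {n : ℕ} (θ : Fin (n + 1) → Fin 2)
    (t : stdSimplex ℝ (Fin (n + 1))) : unitInterval :=
  stdSimplexHomeomorphUnitInterval (stdSimplex.map θ t)

theorem continuous_simplexParam {n : ℕ} (θ : Fin (n + 1) → Fin 2) :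
    Continuous (simplexParam θ) :=
  stdSimplexHomeomorphUnitInterval.continuous.comp (stdSimplex.continuous_map θ)

theorem simplexParam_map {m n : ℕ} (θ : Fin (n + 1) → Fin 2) (f : Fin (m + 1) → Fin (n + 1))
    (t : stdSimplex ℝ (Fin (m + 1))) :
    simplexParam θ (stdSimplex.map f t) = simplexParam (θ ∘ f) t :=
  congrArg _ (stdSimplex.map_comp_apply f θ t)

theorem simplexParam_const {n : ℕ} (k : Fin 2) (t : stdSimplex ℝ (Fin (n + 1))) :
    simplexParam (fun _ => k) t =
      stdSimplexHomeomorphUnitInterval (stdSimplex.vertex k) := by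
  have h : stdSimplex.map (fun _ => k) t = stdSimplex.vertex k := by
    rw [stdSimplex.map_eq_affine]
    refine Subtype.ext (funext fun j => ?_)
    rw [stdSimplex.affine_val, ← Finset.sum_mul, t.2.2, one_mul]
  rw [simplexParam, h]

theorem simplexParam_zero {n : ℕ} (t : stdSimplex ℝ (Fin (n + 1))) :
    simplexParam (fun _ => 0) t = 0 :=
  simplexParam_const 0 t

theorem simplexParam_one {n : ℕ} (t : stdSimplex ℝ (Fin (n + 1))) :
    simplexParam (fun _ => 1) t = 1 :=
  simplexParam_const 1 t

theorem tendsto_slice {A : Set X} {h : X → unitInterval → Y}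
    (hc : ∀ x ∈ A, ∀ s, Tendsto (fun p : X × unitInterval => h p.1 p.2)
      (c.nhd x ×ˢ 𝓝 s) (d.nhd (h x s))) (s : unitInterval) {x : X} (hx : x ∈ A) :
    Tendsto (fun x => h x s) (c.nhd x) (d.nhd (h x s)) :=
  (hc x hx s).comp (tendsto_id.prodMk (tendsto_const_nhds (x := s)))

/-- A homotopy that is continuous at the points of `A` induces a homotopy of simplicial sets. -/
noncomputable def homotopyOn {A : Set X} {B : Set Y} (h : X → unitInterval → Y)
    (hc : ∀ x ∈ A, ∀ s, Tendsto (fun p : X × unitInterval => h p.1 p.2)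
      (c.nhd x ×ˢ 𝓝 s) (d.nhd (h x s))) (hAB : ∀ x ∈ A, ∀ s, h x s ∈ B) :
    SSet.Homotopy
      (mapOn (c := c) (d := d) (A := A) (B := B) (fun x => h x 0)
        (fun _ => tendsto_slice hc 0) fun x hx => hAB x hx 0)
      (mapOn (c := c) (d := d) (A := A) (B := B) (fun x => h x 1)
        (fun _ => tendsto_slice hc 1) fun x hx => hAB x hx 1) where
  h :=
    { app := fun n => TypeCat.ofHom fun p =>
        ⟨⟨fun t => h (p.1.1.1 t) (simplexParam (SSet.stdSimplex.asOrderHom p.2) t),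
          isContinuous_of_tendsto fun t => (hc _ (p.1.2 t) _).comp
            ((SingularSimplex.tendsto p.1.1 t).prodMk
              ((continuous_simplexParam _).tendsto t))⟩,
          fun t => hAB _ (p.1.2 t) _⟩
      naturality := fun n m f => by
        refine ConcreteCategory.hom_ext _ _ fun p => Subtype.ext (Subtype.ext (funext fun t => ?_))
        exact congrArg (h (p.1.1.1 (stdSimplex.map f.unop t)))
          (simplexParam_map (SSet.stdSimplex.asOrderHom p.2) f.unop t).symm }
  h₀ := by
    ext n σ
    refine Subtype.ext (Subtype.ext (funext fun t => ?_))
    exact congrArg (h (σ.1.1 t)) (simplexParam_zero t)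
  h₁ := by
    ext n σ
    refine Subtype.ext (Subtype.ext (funext fun t => ?_))
    exact congrArg (h (σ.1.1 t)) (simplexParam_one t)
  rel := by ext _ ⟨⟨_, ⟨⟩⟩, _⟩

/-- The constant singular simplices at the points of a subset `E` of `A`. -/
noncomputable def constSimplices {A : Set X} (E : Set X) (hE : E ⊆ A) :
    (SimplicialObject.const (Type u)).obj E ⟶ (c.simplicesIn A : SSet.{u}) where
  app _ := TypeCat.ofHom fun y =>
    ⟨⟨fun _ => y.1, isContinuous_of_tendsto fun _ =>
      tendsto_const_pure.mono_right (c.pure_le_nhd y.1)⟩, fun _ => hE y.2⟩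
  naturality _ _ _ := rfl

/-- The simplices in a set that contracts to a point are acyclic in positive degrees. -/
theorem isZero_homology_of_contraction {A : Set X} (h : X → unitInterval → X)
    (hc : ∀ x ∈ A, ∀ s, Tendsto (fun p : X × unitInterval => h p.1 p.2)
      (c.nhd x ×ˢ 𝓝 s) (c.nhd (h x s))) (hA : ∀ x ∈ A, ∀ s, h x s ∈ A)
    (h0 : ∀ x ∈ A, ∀ y ∈ A, h x 0 = h y 0) (h1 : ∀ x ∈ A, h x 1 = x) {n : ℕ} (hn : n ≠ 0) :
    IsZero ((SSet.intChains.obj (c.simplicesIn A : SSet.{u})).homology n) := by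
  have H := (homotopyOn h hc hA).homologyMap_intChains_eq n
  have hid : mapOn (c := c) (d := c) (A := A) (B := A) (fun x => h x 1)
      (fun _ => tendsto_slice hc 1) (fun x hx => hA x hx 1) = 𝟙 _ := by
    ext k σ
    exact Subtype.ext (Subtype.ext (funext fun t => h1 _ (σ.2 t)))
  -- The other end of the homotopy factors through a constant simplicial set. Its set of values
  -- has at most one element; it is empty if `A` is.
  let E : Set X := {y | ∃ x ∈ A, h x 0 = y}
  have hEA : E ⊆ A := by
    rintro _ ⟨x, hx, rfl⟩
    exact hA x hx 0
  have hE : ∀ y ∈ E, ∀ z ∈ E, y = z := by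
    rintro _ ⟨x, hx, rfl⟩ _ ⟨x', hx', rfl⟩
    exact h0 x hx x' hx'
  let p : (c.simplicesIn A : SSet.{u}) ⟶ (SimplicialObject.const (Type u)).obj E :=
    { app := fun k => TypeCat.ofHom fun σ =>
        ⟨h (σ.1.1 stdSimplex.barycenter) 0, _, σ.2 _, rfl⟩
      naturality := fun k l f => ConcreteCategory.hom_ext _ _ fun σ =>
        Subtype.ext (hE _ (Subtype.property _) _ (Subtype.property _)) }
  have hfac : mapOn (c := c) (d := c) (A := A) (B := A) (fun x => h x 0)
      (fun _ => tendsto_slice hc 0) (fun x hx => hA x hx 0) = p ≫ constSimplices E hEA := by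
    ext k σ
    exact Subtype.ext (Subtype.ext (funext fun t => h0 _ (σ.2 t) _ (σ.2 _)))
  rw [hid, hfac, Functor.map_comp, CategoryTheory.Functor.map_id, HomologicalComplex.homologyMap_comp,
    HomologicalComplex.homologyMap_id,
    (SSet.isZero_homology_intChains_const E hn).eq_zero_of_tgt
      (HomologicalComplex.homologyMap (SSet.intChains.map p) n), zero_comp] at H
  exact (IsZero.iff_id_eq_zero _).2 H.symm

end CechClosure

end

section

open CategoryTheory Limits Simplicial Opposite Filter Topology

namespace CechClosure

/-! ### The two cones and the equator of the suspension -/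

open Suspension

variable {X : Type u} (c : CechClosure X)

theorem simplicesIn_inf (A B : Set X) :
    c.simplicesIn A ⊓ c.simplicesIn B = c.simplicesIn (A ∩ B) := by
  ext n σ
  exact forall_and.symm

theorem simplicesIn_univ : c.simplicesIn Set.univ = ⊤ := by
  ext n σ
  exact iff_true_intro fun _ => trivial

/-- The cone on the side of the pole at height `0` is contractible. -/
theorem isZero_homology_lowerCone {n : ℕ} (hn : n ≠ 0) :
    IsZero ((SSet.intChains.obj
      (c.suspension.simplicesIn {y | y.height ≠ 1} : SSet.{u})).homology n) := by
  refine isZero_homology_of_contraction (slide fun t s => t * s)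
    (fun y hy s => c.tendsto_slide continuous_mul (fun _ s => zero_mul s)
      (fun h => (hy h).elim) s) ?_ ?_ ?_ hn
  · intro y hy s hs
    rw [height_slide] at hs
    exact hy (le_antisymm unitInterval.le_one' (hs ▸ unitInterval.mul_le_left))
  · intro y _ z _
    refine eq_of_height_eq ?_ (Or.inl ?_) <;> simp
  · intro y _
    simp [slide]

/-- The cone on the side of the pole at height `1` is contractible. -/
theorem isZero_homology_upperCone {n : ℕ} (hn : n ≠ 0) :
    IsZero ((SSet.intChains.obj
      (c.suspension.simplicesIn {y | y.height ≠ 0} : SSet.{u})).homology n) := by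
  refine isZero_homology_of_contraction
    (slide fun t s => unitInterval.symm (unitInterval.symm t * s))
    (fun y hy s => c.tendsto_slide (by fun_prop) (fun h => (hy h).elim) (fun _ s => by simp) s)
    ?_ ?_ ?_ hn
  · intro y hy s hs
    rw [height_slide, unitInterval.symm_eq_zero] at hs
    refine hy ?_
    rw [← unitInterval.symm_eq_one]
    exact le_antisymm unitInterval.le_one' (hs ▸ unitInterval.mul_le_left)
  · intro y _ z _
    refine eq_of_height_eq ?_ (Or.inr ?_) <;> simp
  · intro y _
    simp [slide]

/-- The midpoint of the unit interval. -/
noncomputable def midpoint : unitInterval := ⟨1 / 2, by norm_num, by norm_num⟩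

/-- The straight line homotopy from the midpoint of the interval to the identity. -/
noncomputable def toMidpoint (t s : unitInterval) : unitInterval :=
  ⟨t * s + 1 / 2 * (1 - s), by
    have := t.2.1; have := s.2.1; have := s.2.2
    constructor
    · have : (0 : ℝ) ≤ 1 - s := by linarith
      positivity
    · nlinarith [t.2.2]⟩

theorem continuous_toMidpoint :
    Continuous fun p : unitInterval × unitInterval => toMidpoint p.1 p.2 := by
  unfold toMidpoint
  fun_prop

theorem toMidpoint_zero (t : unitInterval) : toMidpoint t 0 = midpoint := by
  ext
  simp [toMidpoint, midpoint]

theorem toMidpoint_one (t : unitInterval) : toMidpoint t 1 = t := by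
  ext
  simp [toMidpoint]

theorem toMidpoint_ne_zero {t : unitInterval} (ht : t ≠ 0) (s : unitInterval) :
    toMidpoint t s ≠ 0 := by
  intro h
  have h' : (t : ℝ) * s + 1 / 2 * (1 - s) = 0 := congrArg Subtype.val h
  have ht' : (0 : ℝ) < t := unitInterval.pos_iff_ne_zero.2 ht
  have hts : 0 ≤ (t : ℝ) * s := mul_nonneg ht'.le s.2.1
  have hs : (s : ℝ) = 1 := by linarith [s.2.2]
  rw [hs] at h'
  linarith

theorem toMidpoint_ne_one {t : unitInterval} (ht : t ≠ 1) (s : unitInterval) :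
    toMidpoint t s ≠ 1 := by
  intro h
  have h' : (t : ℝ) * s + 1 / 2 * (1 - s) = 1 := congrArg Subtype.val h
  have ht' : (t : ℝ) < 1 := unitInterval.lt_one_iff_ne_one.2 ht
  have hts : 0 ≤ (1 - (t : ℝ)) * s := mul_nonneg (by linarith) s.2.1
  have hs : (s : ℝ) = 1 := by linarith [s.2.2]
  rw [hs] at h'
  linarith

theorem midpoint_ne_zero : midpoint ≠ 0 := by
  rw [← toMidpoint_zero 1]
  exact toMidpoint_ne_zero one_ne_zero 0

theorem midpoint_ne_one : midpoint ≠ 1 := by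
  rw [← toMidpoint_zero 0]
  exact toMidpoint_ne_one zero_ne_one 0

/-- The complement of the poles of the suspension has the homology of the original space. -/
noncomputable def homologyEquatorIso (n : ℕ) :
    (SSet.intChains.obj (c.suspension.simplicesIn
      ({y | y.height ≠ 1} ∩ {y | y.height ≠ 0}) : SSet.{u})).homology n ≅
      (SSet.intChains.obj (c.simplicesIn Set.univ : SSet.{u})).homology n :=
  let W : Set (Suspension X) := {y | y.height ≠ 1} ∩ {y | y.height ≠ 0}
  let p : (c.suspension.simplicesIn W : SSet.{u}) ⟶ (c.simplicesIn Set.univ : SSet.{u}) :=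
    mapOn base (fun _ hy => c.tendsto_base hy.2 hy.1) (Set.mapsTo_univ _ _)
  let i : (c.simplicesIn Set.univ : SSet.{u}) ⟶ (c.suspension.simplicesIn W : SSet.{u}) :=
    mapOn (fun x => point x midpoint)
      (fun x _ => (c.tendsto_point x midpoint).comp
        (tendsto_id.prodMk (tendsto_const_nhds (x := midpoint))))
      (fun _ _ => ⟨midpoint_ne_one, midpoint_ne_zero⟩)
  have hip : i ≫ p = 𝟙 _ := by
    ext n σ
    exact Subtype.ext (Subtype.ext (funext fun t => base_point midpoint_ne_zero midpoint_ne_one))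
  have hpi : HomologicalComplex.homologyMap (SSet.intChains.map (p ≫ i)) n =
      HomologicalComplex.homologyMap (SSet.intChains.map (𝟙 _)) n := by
    have hc : ∀ y ∈ W, ∀ s, Tendsto (fun q : Suspension X × unitInterval =>
        slide toMidpoint q.1 q.2) (c.suspension.nhd y ×ˢ 𝓝 s)
        (c.suspension.nhd (slide toMidpoint y s)) := fun y hy s =>
      c.tendsto_slide continuous_toMidpoint (fun h => (hy.2 h).elim) (fun h => (hy.1 h).elim) s
    have hW : ∀ y ∈ W, ∀ s, slide toMidpoint y s ∈ W := fun y hy s =>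
      ⟨toMidpoint_ne_one hy.1 s, toMidpoint_ne_zero hy.2 s⟩
    have H := (homotopyOn (slide toMidpoint) hc hW).homologyMap_intChains_eq n
    convert H using 3
    · ext n σ
      refine Subtype.ext (Subtype.ext (funext fun t => ?_))
      exact congrArg (point _) (toMidpoint_zero _).symm
    · ext n σ
      refine Subtype.ext (Subtype.ext (funext fun t => ?_))
      exact (point_base_height _).symm.trans (congrArg (point _) (toMidpoint_one _).symm)
  { hom := HomologicalComplex.homologyMap (SSet.intChains.map p) n
    inv := HomologicalComplex.homologyMap (SSet.intChains.map i) n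
    hom_inv_id := by
      rw [← HomologicalComplex.homologyMap_comp, ← Functor.map_comp, hpi,
        CategoryTheory.Functor.map_id, HomologicalComplex.homologyMap_id]
    inv_hom_id := by
      rw [← HomologicalComplex.homologyMap_comp, ← Functor.map_comp, hip,
        CategoryTheory.Functor.map_id, HomologicalComplex.homologyMap_id] }

theorem continuous_height_comp {n : ℕ} (σ : c.suspension.SingularSimplex n) :
    Continuous fun t => height (σ.1 t) :=
  continuous_iff_continuousAt.2 fun t =>
    (c.tendsto_height (σ.1 t)).comp (SingularSimplex.tendsto σ t)

/-- Singular simplices that avoid one of the poles compute the homology of the suspension. -/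
theorem isIso_homologyMap_cones (n : ℕ) :
    IsIso (HomologicalComplex.homologyMap (SSet.intChains.map
      (c.suspension.simplicesIn {y | y.height ≠ 1} ⊔
        c.suspension.simplicesIn {y | y.height ≠ 0}).ι) (n + 1)) := by
  refine isIso_homologyMap_subcomplex _ ?_ ?_ n
  · rintro n k σ (hσ | hσ) v
    · exact Or.inl fun t => hσ _
    · exact Or.inr fun t => hσ _
  · intro n σ
    have hcover := TupleChain.eventually_sd_pow_mem
      (c := fun b : Bool => {t | height (σ.1 t) ≠ bif b then 1 else 0})
      (fun b => isOpen_ne_fun (c.continuous_height_comp σ) continuous_const)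
      (fun t => by
        by_cases h : height (σ.1 t) = 1
        · exact ⟨false, by simp [h]⟩
        · exact ⟨true, h⟩)
      (stdSimplex.vertex : Fin (n + 1) → _)
    refine hcover.mono fun m hm => Finsupp.supported_mono ?_ hm
    rintro v ⟨_ | _, hv⟩
    · exact Or.inr fun t => hv ⟨t, rfl⟩
    · exact Or.inl fun t => hv ⟨t, rfl⟩

/-- The suspension isomorphism: the Mayer–Vietoris connecting homomorphism of the two cones,
followed by the identification of the homology of their intersection. -/
theorem nonempty_singularHomology_suspension_iso (k : ℕ) (hk : 1 ≤ k) :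
    Nonempty (c.suspension.singularHomology (k + 1) ≅ c.singularHomology k) := by
  obtain ⟨mv⟩ := SSet.nonempty_mayerVietorisIso
    (c.suspension.simplicesIn {y | y.height ≠ 1}) (c.suspension.simplicesIn {y | y.height ≠ 0}) k
    (fun m hm => c.isZero_homology_lowerCone (by lia))
    (fun m hm => c.isZero_homology_upperCone (by lia))
  rw [simplicesIn_inf] at mv
  have := c.isIso_homologyMap_cones k
  let e : c.suspension.singularHomology (k + 1) ≅ c.singularHomology k :=
    (asIso (HomologicalComplex.homologyMap (SSet.intChains.map
      (c.suspension.simplicesIn {y | y.height ≠ 1} ⊔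
        c.suspension.simplicesIn {y | y.height ≠ 0}).ι) (k + 1))).symm ≪≫ mv ≪≫
    c.homologyEquatorIso k ≪≫
    (HomologicalComplex.homologyFunctor _ _ k).mapIso (SSet.intChains.mapIso
      (SSet.Subcomplex.eqToIso c.simplicesIn_univ ≪≫ SSet.Subcomplex.topIso _))
  exact ⟨e⟩

end CechClosure

end

theorem mainTheorem12 {X : Type*} (c : CechClosure X) (k : ℕ) (hk : 1 ≤ k) :
    Nonempty (c.suspension.singularHomology (k + 1) ≃+ c.singularHomology k) := by
  obtain ⟨e⟩ := c.nonempty_singularHomology_suspension_iso k hk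
  exact ⟨e.toLinearEquiv.toAddEquiv⟩
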